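/- Let $X$ be a compact metric space (for instance a compact convex set), let $\mathcal M(X)$, $\mathcal M^{+}(X)$ and $\mathcal M^{+*}(X)$ be the finite signed, finite positive, and nonzero finite positive Borel measures on $X$, and let $\varepsilon>0$. Let $C:X\times X\to\mathbb R$ be a continuous symmetric cost with $C(x,x)=0$ that is $\gamma$-Lipschitz in each variable: $|C(x,z)-C(y,z)|\le\gamma\, d(x,y)$. Let $\varphi:[0,\infty)\to[0,\infty]$ be an entropy function (convex, lower semicontinuous, $\varphi(1)=0$), with recession constant $\varphi'_\infty=\lim_{p\to\infty}\varphi(p)/p$, conjugate $\varphi^*(q)=\sup_{p\ge0}(pq-\varphi(p))\in(-\infty,+\infty]$ and Csiszár divergence $D_\varphi(\mu|\nu)=\int\varphi\big(\tfrac{d\mu}{d\nu}\big)\,d\nu+\varphi'_\infty\,\mu^\perp(X)$, where $\mu=\tfrac{d\mu}{d\nu}\nu+\mu^\perp$ is the Lebesgue decomposition. For $\alpha,\beta\in\mathcal M^+(X)$ put $$\mathrm{OT}_\varepsilon(\alpha,\beta)=\inf_{\pi\in\mathcal M^+(X\times X)}\int C\,d\pi+D_\varphi(\pi_1|\alpha)+D_\varphi(\pi_2|\beta)+\varepsilon\,\mathrm{KL}(\pi|\alpha\otimes\beta),$$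 where $\pi_1,\pi_2$ are the marginals of $\pi$ and $\mathrm{KL}(\pi|\rho)=\int\log\tfrac{d\pi}{d\rho}\,d\pi-\pi(X^2)+\rho(X^2)$ (and $+\infty$ if $\pi\not\ll\rho$). Assume that (1) $\varphi^*$ is strictly convex on its domain $\mathrm{dom}\,\varphi^*=\{\varphi^*<\infty\}$, and (2) there are $x_n\in\mathrm{dom}\,\varphi^*$ and $s_n\in\partial\varphi^*(x_n)$ such that $s_n\to0$ or $s_n\to+\infty$. Let $\alpha,\beta\in\mathcal M^{+*}(X)$. Then there is exactly one pair $(f,g)\in\mathcal C(X)^2$ that satisfies, for all $x,y\in X$, $$f(x)=-\mathrm{aprox}\big(-\mathrm{Smin}_\beta(C(x,\cdot)-g)\big),\qquad g(y)=-\mathrm{aprox}\big(-\mathrm{Smin}_\alpha(C(\cdot,y)-f)\big),$$ where $\mathrm{Smin}_\mu(h)=-\varepsilon\log\int e^{-h/\varepsilon}\,d\mu$ and $\mathrm{aprox}(p)=\arg\min_{q\in\mathbb R}\ \varepsilon e^{(p-q)/\varepsilon}+\varphi^*(q)$. It maximizes the dual functional $$(f',g')\mapsto-\int\varphi^*(-f')\,d\alpha-\int\varphi^*(-g')\,d\beta-\varepsilon\int\big(e^{(f'(x)+g'(y)-C(x,y))/\varepsilon}-1\big)\,d\alpha(x)\,d\beta(y)$$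 over $\mathcal C(X)^2$. The functions $$G_1(x)=-\varphi^*(-f(x))-\varepsilon\int\big(e^{(f(x)+g(y)-C(x,y))/\varepsilon}-1\big)\,d\beta(y),$$ $$G_2(y)=-\varphi^*(-g(y))-\varepsilon\int\big(e^{(f(x)+g(y)-C(x,y))/\varepsilon}-1\big)\,d\alpha(x)$$ are finite and continuous on $X$, and $\mathrm{OT}_\varepsilon$ is finite and differentiable at $(\alpha,\beta)$ with gradients $\nabla_\alpha\mathrm{OT}_\varepsilon=G_1$ and $\nabla_\beta\mathrm{OT}_\varepsilon=G_2$: for all $\delta\alpha,\delta\beta\in\mathcal M(X)$, $$\mathrm{OT}_\varepsilon(\alpha+t\,\delta\alpha,\beta+t\,\delta\beta)=\mathrm{OT}_\varepsilon(\alpha,\beta)+t\int G_1\,d\delta\alpha+t\int G_2\,d\delta\beta+o(t)$$ as $t\to0$ among those $t$ for which $\alpha+t\,\delta\alpha$ and $\beta+t\,\delta\beta$ are positive measures. Furthermore, at every $x$ such that $\varphi^*$ is differentiable at $-f(x)$ one has $(\varphi^*)'(-f(x))=\int e^{(f(x)+g(y)-C(x,y))/\varepsilon}\,d\beta(y)$,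 and at every $y$ such that $\varphi^*$ is differentiable at $-g(y)$ one has $(\varphi^*)'(-g(y))=\int e^{(f(x)+g(y)-C(x,y))/\varepsilon}\,d\alpha(x)$; in particular these hold on all of $X$ if $\varphi^*$ is differentiable on its domain. -/

import Mathlib

open MeasureTheory Filter Topology
open scoped NNReal ENNReal

namespace UnbalancedOT

noncomputable section

/-! ### Entropy functions and their conjugates -/

/-- An entropy function: `φ : [0, ∞) → [0, ∞]`, convex, lower semicontinuous, with `φ 1 = 0`. -/
structure IsEntropyFunction (φ : ℝ≥0 → ℝ≥0∞) : Prop where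
  convex : ConvexOn ℝ≥0 Set.univ φ
  lsc : LowerSemicontinuous φ
  map_one : φ 1 = 0

/-- The recession constant `lim_{p → ∞} φ p / p` (for an entropy function the limit exists in
`[0, ∞]`, so that it equals the upper limit). -/
def recessionConst (φ : ℝ≥0 → ℝ≥0∞) : ℝ≥0∞ :=
  limsup (fun p : ℝ≥0 => φ p / (p : ℝ≥0∞)) atTop

/-- The Legendre conjugate `φ* q = sup_{p ≥ 0} (p q - φ p)`, with values in the extended reals. -/
def conj (φ : ℝ≥0 → ℝ≥0∞) (q : ℝ) : EReal :=
  ⨆ p : ℝ≥0, (((p : ℝ) * q : ℝ) : EReal) - (φ p : EReal)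

/-- The effective domain of an extended-real-valued function on the line. -/
def effDom (h : ℝ → EReal) : Set ℝ := {q | h q < ⊤}

/-- `s` is a subgradient of `h` at `x`, i.e. `s ∈ ∂h(x)`. -/
def IsSubgradient (h : ℝ → EReal) (x s : ℝ) : Prop :=
  ∀ y : ℝ, h x + ((s * (y - x) : ℝ) : EReal) ≤ h y

/-- The extended-real-valued function `h` is finite near `q` and has derivative `d` at `q`. -/
def HasFiniteDerivAt (h : ℝ → EReal) (d q : ℝ) : Prop :=
  ∃ h₀ : ℝ → ℝ, (∀ᶠ r in 𝓝 q, h r = (h₀ r : EReal)) ∧ HasDerivAt h₀ d q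

/-- First assumption: `φ*` is strictly convex (on its domain). -/
def ConjStrictConvex (φ : ℝ≥0 → ℝ≥0∞) : Prop :=
  StrictConvexOn ℝ (effDom (conj φ)) (fun q => (conj φ q).toReal)

/-- Second assumption: there are `x n ∈ dom φ*` and `s n ∈ ∂φ*(x n)` such that `s n` tends to
`0` or to `+∞`. -/
def ConjSlopesDegenerate (φ : ℝ≥0 → ℝ≥0∞) : Prop :=
  ∃ x s : ℕ → ℝ, (∀ n, x n ∈ effDom (conj φ) ∧ IsSubgradient (conj φ) (x n) (s n)) ∧
    (Tendsto s atTop (𝓝 0) ∨ Tendsto s atTop atTop)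

/-! ### The regularized unbalanced optimal transport cost -/

/-- The Csiszár divergence
`D_φ(μ | ν) = ∫ φ(dμ/dν) dν + φ'_∞ · μ^⊥(X)`, where `μ = (dμ/dν) ν + μ^⊥`. -/
def csiszarDiv {Y : Type*} [MeasurableSpace Y] (φ : ℝ≥0 → ℝ≥0∞) (μ ν : Measure Y) : ℝ≥0∞ :=
  ∫⁻ y, φ (μ.rnDeriv ν y).toNNReal ∂ν + recessionConst φ * μ.singularPart ν Set.univ

variable {X : Type*} [MeasurableSpace X]

/-- The regularized unbalanced transport cost, in its primal form
`OT_ε(α, β) = inf_π ∫ C dπ + D_φ(π₁ | α) + D_φ(π₂ | β) + ε KL(π | α ⊗ β)`,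
the infimum being over all finite positive measures `π` on `X × X`. The divergence
`KL(π | ρ) = ∫ log (dπ/dρ) dπ - π(X²) + ρ(X²)` between unnormalized measures is Mathlib's
`klDiv`. -/
def OT (φ : ℝ≥0 → ℝ≥0∞) (C : X → X → ℝ) (ε : ℝ) (α β : FiniteMeasure X) : EReal :=
  ⨅ π : FiniteMeasure (X × X),
    ((∫ z, C z.1 z.2 ∂(π : Measure (X × X)) : ℝ) : EReal) +
      ((csiszarDiv φ (π : Measure (X × X)).fst (α : Measure X) +
        csiszarDiv φ (π : Measure (X × X)).snd (β : Measure X) +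
        ENNReal.ofReal ε * InformationTheory.klDiv (π : Measure (X × X))
          ((α : Measure X).prod (β : Measure X)) : ℝ≥0∞) : EReal)

/-! ### Dual potentials -/

/-- The integral of an extended-real-valued function: positive part minus negative part. -/
def extIntegral (μ : Measure X) (h : X → EReal) : EReal :=
  ((∫⁻ x, (h x).toENNReal ∂μ : ℝ≥0∞) : EReal) - ((∫⁻ x, (-(h x)).toENNReal ∂μ : ℝ≥0∞) : EReal)

/-- The dual functional
`-⟨α, φ*(-f)⟩ - ⟨β, φ*(-g)⟩ - ε ⟨α ⊗ β, exp((f ⊕ g - C)/ε) - 1⟩`. -/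
def dualFunctional (φ : ℝ≥0 → ℝ≥0∞) (C : X → X → ℝ) (ε : ℝ) (α β : FiniteMeasure X)
    (f g : X → ℝ) : EReal :=
  -extIntegral (α : Measure X) (fun x => conj φ (-f x)) -
    extIntegral (β : Measure X) (fun y => conj φ (-g y)) -
    ((ε * ∫ z, (Real.exp ((f z.1 + g z.2 - C z.1 z.2) / ε) - 1)
      ∂((α : Measure X).prod (β : Measure X)) : ℝ) : EReal)

/-- The Softmin operator `Smin(h) = -ε log ⟨α, exp(-h/ε)⟩`. -/
def softmin (ε : ℝ) (α : FiniteMeasure X) (h : X → ℝ) : ℝ :=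
  -ε * Real.log (∫ x, Real.exp (-h x / ε) ∂(α : Measure X))

/-- `q = aprox_h^ε(p)`, i.e. `q` minimizes `r ↦ ε exp((p - r)/ε) + h r` over the line. (The
minimizer is unique as soon as `h` is convex and not identically `+∞`.) -/
def IsAprox (ε : ℝ) (h : ℝ → EReal) (p q : ℝ) : Prop :=
  IsMinOn (fun r : ℝ => ((ε * Real.exp ((p - r) / ε) : ℝ) : EReal) + h r) Set.univ q

/-- `(f, g)` is a fixed point of the Sinkhorn map everywhere on `X`:
`f x = -aprox(-Smin_β(C(x, ·) - g))` for every `x`, and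
`g y = -aprox(-Smin_α(C(·, y) - f))` for every `y`, with `aprox = aprox_{φ*}^ε`. -/
def IsSinkhornFixedPoint (φ : ℝ≥0 → ℝ≥0∞) (C : X → X → ℝ) (ε : ℝ) (α β : FiniteMeasure X)
    (f g : X → ℝ) : Prop :=
  (∀ x, IsAprox ε (conj φ) (-softmin ε β (fun y => C x y - g y)) (-f x)) ∧
    (∀ y, IsAprox ε (conj φ) (-softmin ε α (fun x => C x y - f x)) (-g y))

/-! ### Differentiability of functionals of measures -/

/-- The pairing `⟨δ, G⟩` of a signed measure with a function, through the Jordan decomposition. -/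
def signedPairing (δ : SignedMeasure X) (G : X → ℝ) : ℝ :=
  ∫ x, G x ∂δ.toJordanDecomposition.posPart - ∫ x, G x ∂δ.toJordanDecomposition.negPart

/-- The functional `F` on pairs of positive measures is finite and differentiable at `(α, β)`,
with gradients `G₁` and `G₂`: for all signed measures `δα` and `δβ`,
`F(α + t δα, β + t δβ) = F(α, β) + t ⟨δα, G₁⟩ + t ⟨δβ, G₂⟩ + o(t)` as `t → 0` among those `t`
for which `α + t δα` and `β + t δβ` are positive measures. -/
def HasMeasureGradientAt [TopologicalSpace X] (F : FiniteMeasure X → FiniteMeasure X → EReal)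
    (G₁ G₂ : C(X, ℝ)) (α β : FiniteMeasure X) : Prop :=
  ∃ v : ℝ, F α β = (v : EReal) ∧
    ∀ δα δβ : SignedMeasure X, ∃ r : ℝ → ℝ, r =o[𝓝 0] (fun t : ℝ => t) ∧
      ∀ᶠ t : ℝ in 𝓝 0, ∀ α' β' : FiniteMeasure X,
        (α' : Measure X).toSignedMeasure = (α : Measure X).toSignedMeasure + t • δα →
        (β' : Measure X).toSignedMeasure = (β : Measure X).toSignedMeasure + t • δβ →
        F α' β' =
          ((v + t * signedPairing δα G₁ + t * signedPairing δβ G₂ + r t : ℝ) : EReal)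

end

end UnbalancedOT

/-! Minimality in `aprox` is a first-order condition: `q = aprox(p)` exactly when `exp((p - q)/ε) ∈
∂φ*(q)`. For `p = -Smin` this slope is an integral, so a Sinkhorn fixed point is a pair with `∫
exp((f x + g y - C x y)/ε) dβ(y) ∈ ∂φ*(-f x)` for every `x`, and symmetrically for `g`
(`isSinkhornFixedPoint_iff`). These are the optimality conditions of the dual problem.

Existence: `∂φ*` is monotone and `exp` strictly increasing, so the response to a potential is
unique, order reversing and Lipschitz, and two successive responses form a monotone map. Assumption
(2) makes large constants supersolutions (`exists_const_supersolution`); with the roles of `α` and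
`β` exchanged it also yields a subsolution, and monotone iteration converges to a fixed point
because the graph of `∂φ*` is closed.

Uniqueness (`fixedPoint_unique`): integrating the monotonicity of `∂φ*` against that of `exp` forces
the two plans to coincide almost everywhere. Strict convexity of `φ*` then identifies the potentials
almost everywhere, and the fixed point equations identify them everywhere.

Differentiability: the potentials are frozen while the measures move. Weak duality bounds the
perturbed cost below by the dual value at `(f, g)`, an explicit quadratic polynomial in `t`
(`dualValue_perturb`). For the upper bound, the plan with density `exp((f ⊕ g - C)/ε)` with respect
to the perturbed product has marginal densities moved by `O(t)`. Strict convexity of `φ*`, the dual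
form of smoothness of `φ`, makes the resulting Fenchel–Young defect `o(t)`, uniformly on the compact
space (`exists_uniform_stability`, `IsDualCritical.eventually_OT_le`). Both bounds have the same
linear term. -/

namespace UnbalancedOT

variable {φ : ℝ≥0 → ℝ≥0∞}

/-! ### Entropy functions and their conjugates on the line -/

lemma le_conj {p : ℝ≥0} (hp : φ p ≠ ⊤) (q : ℝ) :
    ((p * q - (φ p).toReal : ℝ) : EReal) ≤ conj φ q := by
  refine le_trans (le_of_eq ?_) (le_iSup _ p)
  rw [EReal.coe_sub, EReal.coe_ennreal_toReal hp]

lemma conj_le {q v : ℝ}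
    (h : ∀ p, φ p ≠ ⊤ → p * q - (φ p).toReal ≤ v) : conj φ q ≤ (v : EReal) := by
  refine iSup_le fun p => ?_
  by_cases hp : φ p = ⊤
  · simp [hp]
  · rw [← EReal.coe_ennreal_toReal hp, ← EReal.coe_sub]
    exact EReal.coe_le_coe_iff.2 (h p hp)

lemma lowerSemicontinuous_conj (φ : ℝ≥0 → ℝ≥0∞) : LowerSemicontinuous (conj φ) := by
  refine lowerSemicontinuous_iSup fun p => ?_
  by_cases hp : φ p = ⊤
  · simpa [hp] using lowerSemicontinuous_const
  · refine Continuous.lowerSemicontinuous ?_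
    rw [← EReal.coe_ennreal_toReal hp]
    simp_rw [← EReal.coe_sub]
    exact continuous_coe_real_ereal.comp (by fun_prop)


lemma coe_le_conj (hφ : IsEntropyFunction φ) (q : ℝ) : (q : EReal) ≤ conj φ q := by
  simpa [hφ.map_one] using le_conj (φ := φ) (p := 1) (by simp [hφ.map_one]) q

lemma conj_ne_bot (hφ : IsEntropyFunction φ) (q : ℝ) : conj φ q ≠ ⊥ :=
  ne_bot_of_le_ne_bot (EReal.coe_ne_bot q) (coe_le_conj hφ q)

lemma conj_zero (hφ : IsEntropyFunction φ) : conj φ 0 = 0 := by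
  refine le_antisymm ?_ (by simpa using coe_le_conj hφ 0)
  simpa using conj_le (φ := φ) (q := 0) (v := 0) (by simp)

lemma coe_toReal_conj (hφ : IsEntropyFunction φ) {q : ℝ} (h : conj φ q ≠ ⊤) :
    (((conj φ q).toReal : ℝ) : EReal) = conj φ q :=
  EReal.coe_toReal h (conj_ne_bot hφ q)

lemma toReal_conj_zero (hφ : IsEntropyFunction φ) : (conj φ 0).toReal = 0 := by
  simp [conj_zero hφ]

/-- The Fenchel--Young inequality. -/
lemma mul_sub_le_toReal_conj (hφ : IsEntropyFunction φ) {p : ℝ≥0} {q : ℝ} (hp : φ p ≠ ⊤)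
    (hq : conj φ q ≠ ⊤) : p * q - (φ p).toReal ≤ (conj φ q).toReal := by
  rw [← EReal.coe_le_coe_iff, coe_toReal_conj hφ hq]
  exact le_conj hp q

lemma IsSubgradient.conj_ne_top (hφ : IsEntropyFunction φ) {q s : ℝ}
    (h : IsSubgradient (conj φ) q s) : conj φ q ≠ ⊤ := by
  intro hq
  have := h 0
  rw [hq, conj_zero hφ, EReal.top_add_coe] at this
  simp at this

lemma IsSubgradient.le (hφ : IsEntropyFunction φ) {q s : ℝ}
    (h : IsSubgradient (conj φ) q s) {y : ℝ} (hy : conj φ y ≠ ⊤) :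
    (conj φ q).toReal + s * (y - q) ≤ (conj φ y).toReal := by
  rw [← EReal.coe_le_coe_iff, EReal.coe_add, coe_toReal_conj hφ hy,
    coe_toReal_conj hφ (h.conj_ne_top hφ)]
  exact h y

lemma isSubgradient_of_le (hφ : IsEntropyFunction φ) {q s : ℝ} (hq : conj φ q ≠ ⊤)
    (h : ∀ y, conj φ y ≠ ⊤ → (conj φ q).toReal + s * (y - q) ≤ (conj φ y).toReal) :
    IsSubgradient (conj φ) q s := by
  intro y
  by_cases hy : conj φ y = ⊤
  · simp [hy]
  · rw [← coe_toReal_conj hφ hq, ← coe_toReal_conj hφ hy, ← EReal.coe_add]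
    exact EReal.coe_le_coe_iff.2 (h y hy)

lemma isSubgradient_zero_one (hφ : IsEntropyFunction φ) : IsSubgradient (conj φ) 0 1 := by
  intro y
  simpa [conj_zero hφ] using coe_le_conj hφ y

/-- Subgradients are monotone. -/
lemma IsSubgradient.mul_nonneg (hφ : IsEntropyFunction φ) {q s q' s' : ℝ}
    (h : IsSubgradient (conj φ) q s) (h' : IsSubgradient (conj φ) q' s') :
    0 ≤ (s - s') * (q - q') := by
  have := h.le hφ (h'.conj_ne_top hφ)
  have := h'.le hφ (h.conj_ne_top hφ)
  nlinarith

lemma IsSubgradient.le_of_lt (hφ : IsEntropyFunction φ) {q s q' s' : ℝ}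
    (h : IsSubgradient (conj φ) q s) (h' : IsSubgradient (conj φ) q' s') (hq : q < q') :
    s ≤ s' := by
  have := h.mul_nonneg hφ h'
  by_contra! hs
  nlinarith [mul_pos (sub_pos.2 hs) (sub_pos.2 hq)]

lemma ConjStrictConvex.toReal_le (h₁ : ConjStrictConvex φ) {q r m l : ℝ} (hq : conj φ q ≠ ⊤)
    (hr : conj φ r ≠ ⊤) (h0 : 0 ≤ l) (h1 : l ≤ 1) (hm : m = (1 - l) * q + l * r) :
    conj φ m ≠ ⊤ ∧ (conj φ m).toReal ≤ (1 - l) * (conj φ q).toReal + l * (conj φ r).toReal := by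
  have hc : ConvexOn ℝ (effDom (conj φ)) (fun q => (conj φ q).toReal) := StrictConvexOn.convexOn h₁
  have hqm : q ∈ effDom (conj φ) := lt_top_iff_ne_top.2 hq
  have hrm : r ∈ effDom (conj φ) := lt_top_iff_ne_top.2 hr
  have hm1 := hc.1 hqm hrm (by linarith : 0 ≤ 1 - l) h0 (by ring)
  have hm2 := hc.2 hqm hrm (by linarith : 0 ≤ 1 - l) h0 (by ring)
  simp only [smul_eq_mul, ← hm] at hm1 hm2
  exact ⟨ne_of_lt hm1, hm2⟩

/-- A slope supporting `φ*` at two points makes it affine between them; the midpoint contradicts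
strict convexity. -/
lemma IsSubgradient.eq_of_strictConvex (hφ : IsEntropyFunction φ) (h₁ : ConjStrictConvex φ)
    {q q' s : ℝ} (h : IsSubgradient (conj φ) q s) (h' : IsSubgradient (conj φ) q' s) : q = q' := by
  by_contra hne
  have hq := h.conj_ne_top hφ
  have hq' := h'.conj_ne_top hφ
  have hs : StrictConvexOn ℝ (effDom (conj φ)) (fun q => (conj φ q).toReal) := h₁
  have hqm : q ∈ effDom (conj φ) := lt_top_iff_ne_top.2 hq
  have hqm' : q' ∈ effDom (conj φ) := lt_top_iff_ne_top.2 hq'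
  have hhalf : (0 : ℝ) < 1 / 2 := by norm_num
  have key := hs.2 hqm hqm' hne hhalf hhalf (by norm_num)
  have hmem := hs.1 hqm hqm' hhalf.le hhalf.le (by norm_num)
  have h1 := h.le hφ (ne_of_lt hmem)
  have h2 := h'.le hφ (ne_of_lt hmem)
  simp only [smul_eq_mul] at *
  linarith

/-- Strict convexity makes the inequality of a subgradient strict away from its base point. -/
lemma IsSubgradient.lt_conj (hφ : IsEntropyFunction φ) (h₁ : ConjStrictConvex φ)
    {q s η : ℝ} (h : IsSubgradient (conj φ) q s) (hη : η ≠ 0) :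
    (((conj φ q).toReal + s * η : ℝ) : EReal) < conj φ (q + η) := by
  by_contra! hle
  have hq := h.conj_ne_top hφ
  have hqη : conj φ (q + η) ≠ ⊤ := ne_top_of_le_ne_top (EReal.coe_ne_top _) hle
  rw [← coe_toReal_conj hφ hqη, EReal.coe_le_coe_iff] at hle
  have : IsSubgradient (conj φ) (q + η) s := by
    refine isSubgradient_of_le hφ hqη fun y hy => ?_
    have := h.le hφ hy
    linarith
  exact hη (by linarith [h.eq_of_strictConvex hφ h₁ this])

lemma exists_minOn_Icc (φ : ℝ≥0 → ℝ≥0∞) {c : ℝ → ℝ} (hc : Continuous c) {a b : ℝ}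
    (hab : a ≤ b) :
    ∃ q ∈ Set.Icc a b, ∀ r ∈ Set.Icc a b, (c q : EReal) + conj φ q ≤ (c r : EReal) + conj φ r := by
  have hl : LowerSemicontinuous (fun r : ℝ => (c r : EReal) + conj φ r) :=
    ((continuous_coe_real_ereal.comp hc).lowerSemicontinuous).add' (lowerSemicontinuous_conj φ)
      fun r => EReal.continuousAt_add (Or.inl (EReal.coe_ne_top _)) (Or.inl (EReal.coe_ne_bot _))
  obtain ⟨q, hq, hmin⟩ := (hl.lowerSemicontinuousOn (Set.Icc a b)).exists_isMinOn
    (Set.nonempty_Icc.2 hab) isCompact_Icc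
  exact ⟨q, hq, fun r hr => hmin hr⟩

/-! ### The anisotropic proximity operator -/

/-- The supporting lines at `q` of `φ*` and of `r ↦ ε exp((p - r)/ε)` have opposite slopes, so their
sum is constant. -/
lemma isAprox_of_isSubgradient (hφ : IsEntropyFunction φ) {ε p q : ℝ} (hε : 0 < ε)
    (h : IsSubgradient (conj φ) q (Real.exp ((p - q) / ε))) : IsAprox ε (conj φ) p q := by
  intro r _
  by_cases hr : conj φ r = ⊤
  · change _ ≤ _ + conj φ r
    rw [hr, EReal.coe_add_top]
    exact le_top
  have hq := h.conj_ne_top hφ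
  change _ + conj φ q ≤ _ + conj φ r
  rw [← coe_toReal_conj hφ hq, ← coe_toReal_conj hφ hr, ← EReal.coe_add, ← EReal.coe_add,
    EReal.coe_le_coe_iff]
  have h1 := h.le hφ hr
  have h2 : Real.exp ((p - q) / ε) * ((q - r) / ε + 1) ≤ Real.exp ((p - r) / ε) := by
    rw [show (p - r) / ε = (p - q) / ε + (q - r) / ε by ring, Real.exp_add]
    exact mul_le_mul_of_nonneg_left (Real.add_one_le_exp _) (Real.exp_pos _).le
  have h3 := mul_le_mul_of_nonneg_left h2 hε.le
  have h4 : ε * (Real.exp ((p - q) / ε) * ((q - r) / ε + 1)) =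
      Real.exp ((p - q) / ε) * (q - r) + ε * Real.exp ((p - q) / ε) := by
    field_simp
  linarith

lemma IsAprox.conj_ne_top (hφ : IsEntropyFunction φ) {ε p q : ℝ}
    (h : IsAprox ε (conj φ) p q) : conj φ q ≠ ⊤ := by
  intro hq
  have : (_ : EReal) + conj φ q ≤ _ + conj φ 0 := h (Set.mem_univ 0)
  rw [hq, conj_zero hφ, EReal.coe_add_top, add_zero, top_le_iff] at this
  exact EReal.coe_ne_top _ this

lemma IsAprox.isSubgradient (hφ : IsEntropyFunction φ) (h₁ : ConjStrictConvex φ) {ε p q : ℝ}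
    (hε : 0 < ε) (h : IsAprox ε (conj φ) p q) :
    IsSubgradient (conj φ) q (Real.exp ((p - q) / ε)) := by
  have hq := h.conj_ne_top hφ
  refine isSubgradient_of_le hφ hq fun y hy => ?_
  -- Minimality is tested at the point `q + t (y - q)`: convexity bounds `φ*` there, the tangent of
  -- the exponential at that same point bounds the other term, and a factor `t` cancels.
  have key : ∀ t ∈ Set.Ioo (0 : ℝ) 1, (conj φ q).toReal +
      Real.exp ((p - (q + t * (y - q))) / ε) * (y - q) ≤ (conj φ y).toReal := by
    rintro t ⟨ht0, ht1⟩
    obtain ⟨hmem, hconv⟩ := h₁.toReal_le hq hy ht0.le ht1.le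
      (show q + t * (y - q) = (1 - t) * q + t * y by ring)
    have hmin : (_ : EReal) + conj φ q ≤ _ + conj φ (q + t * (y - q)) :=
      h (Set.mem_univ (q + t * (y - q)))
    rw [← coe_toReal_conj hφ hq, ← coe_toReal_conj hφ hmem, ← EReal.coe_add,
      ← EReal.coe_add, EReal.coe_le_coe_iff] at hmin
    set b := (p - (q + t * (y - q))) / ε with hb
    have h2 : Real.exp b * (t * (y - q) / ε + 1) ≤ Real.exp ((p - q) / ε) := by
      rw [show (p - q) / ε = b + t * (y - q) / ε by rw [hb]; ring, Real.exp_add]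
      exact mul_le_mul_of_nonneg_left (Real.add_one_le_exp _) (Real.exp_pos _).le
    have h3 := mul_le_mul_of_nonneg_left h2 hε.le
    have h4 : ε * (Real.exp b * (t * (y - q) / ε + 1)) =
        t * (Real.exp b * (y - q)) + ε * Real.exp b := by
      field_simp
    have h5 : t * ((conj φ q).toReal + Real.exp b * (y - q)) ≤ t * (conj φ y).toReal := by
      nlinarith
    exact le_of_mul_le_mul_left h5 ht0
  have hlim : Tendsto (fun t : ℝ => (conj φ q).toReal +
      Real.exp ((p - (q + t * (y - q))) / ε) * (y - q)) (𝓝[>] 0)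
      (𝓝 ((conj φ q).toReal + Real.exp ((p - q) / ε) * (y - q))) := by
    have : Continuous (fun t : ℝ => (conj φ q).toReal +
      Real.exp ((p - (q + t * (y - q))) / ε) * (y - q)) := by fun_prop
    simpa using (this.tendsto 0).mono_left nhdsWithin_le_nhds
  exact le_of_tendsto hlim (by
    filter_upwards [Ioo_mem_nhdsGT (zero_lt_one' ℝ)] with t ht using key t ht)

lemma exists_isAprox (hφ : IsEntropyFunction φ) {ε : ℝ} (hε : 0 < ε) (p : ℝ) :
    ∃ q, IsAprox ε (conj φ) p q := by
  set V := ε * Real.exp (p / ε) with hV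
  have hVpos : 0 < V := by positivity
  -- `V` is the objective at `0`. Right of `V`, the bound `φ* r ≥ r` alone exceeds it. Left of `-R`,
  -- with `u = -r/ε > 2ε/V`, the quadratic term `V u²/2` of the exponential beats the loss `r = -ε
  -- u`.
  set R := ε * (2 * ε / V + 1) with hR
  have hRpos : 0 < R := by positivity
  obtain ⟨q, hq, hmin⟩ := exists_minOn_Icc φ
    (c := fun r => ε * Real.exp ((p - r) / ε)) (by fun_prop) (a := -R) (b := V) (by linarith)
  have h0 := hmin 0 ⟨by linarith, hVpos.le⟩
  simp only [conj_zero hφ, add_zero, sub_zero, ← hV] at h0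
  refine ⟨q, fun r _ => ?_⟩
  by_cases hr : r ∈ Set.Icc (-R) V
  · exact hmin r hr
  refine h0.trans ?_
  refine le_trans ?_ (add_le_add_right (coe_le_conj hφ r) _)
  rw [← EReal.coe_add, EReal.coe_le_coe_iff]
  rw [Set.mem_Icc, not_and_or, not_le, not_le] at hr
  rcases hr with hr | hr
  · have hu : 2 * ε / V + 1 < -r / ε := by
      rw [lt_div_iff₀ hε]; linarith
    set u := -r / ε with hu'
    have hu0 : 0 < 2 * ε / V := by positivity
    have h2 := Real.quadratic_le_exp_of_nonneg (x := u) (by linarith)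
    have h3 : ε * Real.exp ((p - r) / ε) = V * Real.exp u := by
      rw [hV, mul_assoc, ← Real.exp_add, hu']; congr 2; ring
    have h4 : r = -(ε * u) := by rw [hu']; field_simp
    rw [h3, h4]
    have h5 := mul_le_mul_of_nonneg_left h2 hVpos.le
    have h6 : 2 * ε < V * u := by
      have : 2 * ε / V < u := by linarith
      rwa [div_lt_iff₀ hVpos, mul_comm u] at this
    nlinarith
  · have := mul_pos hε (Real.exp_pos ((p - r) / ε))
    linarith

/-! ### Biconjugation -/

lemma IsEntropyFunction.toReal_le (hφ : IsEntropyFunction φ) {a b p : ℝ≥0} {l : ℝ} (hl0 : 0 ≤ l)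
    (hl1 : l ≤ 1) (hp : (p : ℝ) = (1 - l) * a + l * b) (ha : φ a ≠ ⊤) (hb : φ b ≠ ⊤) :
    φ p ≠ ⊤ ∧ (φ p).toReal ≤ (1 - l) * (φ a).toReal + l * (φ b).toReal := by
  lift l to ℝ≥0 using hl0
  obtain ⟨k, hk⟩ : ∃ k : ℝ≥0, (k : ℝ) = 1 - l := ⟨⟨1 - l, by linarith⟩, rfl⟩
  have hkl : k + l = 1 := by ext; push_cast; linarith
  have := hφ.convex.2 (Set.mem_univ a) (Set.mem_univ b) (zero_le (a := k)) (zero_le (a := l)) hkl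
  have hpe : k • a + l • b = p := by
    ext; push_cast [smul_eq_mul]; rw [hp, hk]
  rw [hpe] at this
  simp only [ENNReal.smul_def, smul_eq_mul] at this
  have hfin : (k : ℝ≥0∞) * φ a + l * φ b ≠ ⊤ :=
    ENNReal.add_ne_top.2 ⟨ENNReal.mul_ne_top ENNReal.coe_ne_top ha,
      ENNReal.mul_ne_top ENNReal.coe_ne_top hb⟩
  refine ⟨ne_top_of_le_ne_top hfin this, ?_⟩
  have h2 := ENNReal.toReal_mono hfin this
  rw [ENNReal.toReal_add (ENNReal.mul_ne_top ENNReal.coe_ne_top ha)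
    (ENNReal.mul_ne_top ENNReal.coe_ne_top hb), ENNReal.toReal_mul, ENNReal.toReal_mul] at h2
  simpa [hk] using h2

/-- The equality case of the Fenchel--Young inequality. -/
lemma IsSubgradient.apply_le (hφ : IsEntropyFunction φ) {q : ℝ} {s : ℝ≥0}
    (h : IsSubgradient (conj φ) q s) : φ s ≤ ENNReal.ofReal (s * q - (conj φ q).toReal) := by
  by_contra! hlt
  have hq := h.conj_ne_top hφ
  set H := (conj φ q).toReal with hH
  obtain ⟨c, hc1, hc2⟩ := exists_between hlt
  lift c to ℝ≥0 using hc2.ne_top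
  set e := (c : ℝ) - (s * q - H) with he
  have hepos : 0 < e := by
    rw [ENNReal.ofReal_lt_coe_iff] at hc1
    · rw [he]; linarith
    · have := h.le hφ (y := 0) (by simp [conj_zero hφ])
      rw [toReal_conj_zero hφ] at this
      linarith
  -- The Fenchel–Young gap at `q`: convex and nonnegative. The negated claim and lower
  -- semicontinuity keep it at least `e/2` near `s`.
  let ψ : ℝ≥0 → ℝ := fun p => (φ p).toReal - q * p + H
  have hψ0 : ∀ p, φ p ≠ ⊤ → 0 ≤ ψ p := by
    intro p hp
    have := mul_sub_le_toReal_conj hφ hp hq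
    simp only [ψ]; linarith
  have hconv : ∀ (a b p : ℝ≥0) (l : ℝ), 0 ≤ l → l ≤ 1 → (p : ℝ) = (1 - l) * a + l * b →
      φ a ≠ ⊤ → φ b ≠ ⊤ → φ p ≠ ⊤ ∧ ψ p ≤ (1 - l) * ψ a + l * ψ b := by
    intro a b p l h0 h1 hp ha hb
    obtain ⟨k1, k2⟩ := hφ.toReal_le h0 h1 hp ha hb
    refine ⟨k1, ?_⟩
    simp only [ψ]
    rw [hp]
    nlinarith
  -- Otherwise `φ*(q + δ) ≤ H + s δ - κ`, which violates the subgradient inequality.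
  have hstar : ∀ δ κ : ℝ, 0 < κ → ∃ p, φ p ≠ ⊤ ∧ ψ p < δ * (p - s) + κ := by
    intro δ κ hκ
    by_contra! hcon
    have h1 : conj φ (q + δ) ≤ ((H + s * δ - κ : ℝ) : EReal) := by
      refine conj_le fun p hp => ?_
      have := hcon p hp
      simp only [ψ] at this
      nlinarith
    have h2 := h.le hφ (ne_top_of_le_ne_top (EReal.coe_ne_top _) h1)
    rw [← coe_toReal_conj hφ (ne_top_of_le_ne_top (EReal.coe_ne_top _) h1),
      EReal.coe_le_coe_iff] at h1
    rw [← hH] at h2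
    nlinarith
  obtain ⟨η, hη, hnear⟩ : ∃ η > 0, ∀ p : ℝ≥0, |(p : ℝ) - s| < η → φ p ≠ ⊤ → e / 2 ≤ ψ p := by
    obtain ⟨η, hη, hball⟩ := Metric.eventually_nhds_iff.1 (hφ.lsc s c hc2)
    refine ⟨min η (e / 2 / (|q| + 1)), lt_min hη (by positivity), fun p hp hpt => ?_⟩
    have h1 := hball (y := p) (by rw [NNReal.dist_eq]; exact hp.trans_le (min_le_left _ _))
    have h2 : (c : ℝ) < (φ p).toReal := by
      rw [← ENNReal.coe_toReal c]
      exact (ENNReal.toReal_lt_toReal ENNReal.coe_ne_top hpt).2 h1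
    have h3 : |(p : ℝ) - s| * (|q| + 1) < e / 2 := by
      rw [← lt_div_iff₀ (by positivity)]
      exact hp.trans_le (min_le_right _ _)
    have h4 : q * (p - s) ≤ |(p : ℝ) - s| * (|q| + 1) := by
      calc q * (p - s) ≤ |q * (p - s)| := le_abs_self _
        _ = |(p : ℝ) - s| * |q| := by rw [abs_mul, mul_comm]
        _ ≤ _ := mul_le_mul_of_nonneg_left (by linarith) (abs_nonneg _)
    simp only [ψ]
    nlinarith
  have hs_near : φ s ≠ ⊤ → e / 2 ≤ ψ s := hnear s (by simpa using hη)
  -- A point with small gap lies on one side of `s`. Tilting by `δ` of the right sign provides a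
  -- second one across `s`, and convexity then makes the gap at `s` too small.
  obtain ⟨p₀, hp₀, hψp₀⟩ := hstar 0 (e / 4) (by linarith)
  rw [zero_mul, zero_add] at hψp₀
  have hs0 : (0 : ℝ) ≤ s := s.2
  rcases lt_trichotomy (p₀ : ℝ) s with hlt' | heq | hgt
  · set δ := e / 4 / (s + 2 * η + 1) with hδ
    have hδpos : 0 < δ := by positivity
    have hδe : δ * (s + 2 * η + 1) = e / 4 := by rw [hδ]; field_simp
    obtain ⟨p, hp, hψp⟩ := hstar δ (δ * η) (by positivity)
    rcases le_or_gt (p : ℝ) (s - η) with h1 | h1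
    · have := hψ0 p hp
      nlinarith
    rcases lt_or_ge (p : ℝ) s with h2 | h2
    · have := hnear p (by rw [abs_lt]; constructor <;> linarith) hp
      nlinarith
    · have hpp : 0 < (p : ℝ) - p₀ := by linarith
      set l := ((s : ℝ) - p₀) / (p - p₀) with hl
      have hl0 : 0 ≤ l := div_nonneg (by linarith) hpp.le
      have hl1 : l ≤ 1 := (div_le_one hpp).2 (by linarith)
      have hlm : l * (p - p₀) = s - p₀ := by rw [hl]; field_simp
      obtain ⟨k1, k2⟩ := hconv p₀ p s l hl0 hl1 (by linarith) hp₀ hp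
      have k3 := hs_near k1
      have hp00 : (0 : ℝ) ≤ p₀ := p₀.2
      -- The point `p` may be arbitrarily far to the right, but its weight `l` compensates: `l (p -
      -- s) = (1 - l)(s - p₀)`.
      have k4 : l * (p - s) ≤ s := by nlinarith
      have k5 : l * ψ p ≤ l * (δ * (p - s) + δ * η) := mul_le_mul_of_nonneg_left hψp.le hl0
      have k6 : (1 - l) * ψ p₀ ≤ e / 4 := by nlinarith [hψ0 p₀ hp₀]
      have k7 : l * (δ * (p - s) + δ * η) ≤ δ * s + δ * η := by
        have := mul_le_mul_of_nonneg_left k4 hδpos.le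
        have := mul_le_mul_of_nonneg_right hl1 (mul_pos hδpos hη).le
        nlinarith
      nlinarith
  · have hps : p₀ = s := by ext; exact heq
    rw [hps] at hψp₀ hp₀
    linarith [hs_near hp₀]
  · set δ := e / 2 / (s + η + 1) with hδ
    have hδpos : 0 < δ := by positivity
    have hδe : δ * (s + η + 1) = e / 2 := by rw [hδ]; field_simp
    -- On this side `p ≥ 0` bounds the tilt directly, by `δ (s + η) < e/2`.
    obtain ⟨p, hp, hψp⟩ := hstar (-δ) (δ * η) (by positivity)
    have hp0 : (0 : ℝ) ≤ p := p.2
    rcases le_or_gt (s + η) (p : ℝ) with h1 | h1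
    · have := hψ0 p hp
      nlinarith
    have key : e / 2 ≤ ψ p := by
      rcases lt_or_ge (s : ℝ) p with h2 | h2
      · exact hnear p (by rw [abs_lt]; constructor <;> linarith) hp
      · by_contra! hψ
        have hpp : 0 < (p₀ : ℝ) - p := by linarith
        set l := ((s : ℝ) - p) / (p₀ - p) with hl
        have hl0 : 0 ≤ l := div_nonneg (by linarith) hpp.le
        have hl1 : l ≤ 1 := (div_le_one hpp).2 (by linarith)
        have hlm : l * (p₀ - p) = s - p := by rw [hl]; field_simp
        obtain ⟨k1, k2⟩ := hconv p p₀ s l hl0 hl1 (by linarith) hp hp₀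
        have k3 := hs_near k1
        rcases hl0.eq_or_lt with h0 | h0
        · rw [← h0] at k2; linarith
        · nlinarith
    nlinarith

/-- Stability of the equality case of the Fenchel--Young inequality, given a quantitative strict
convexity gap `c` of `φ*` at distance `η` from the base point. -/
lemma IsSubgradient.apply_le_of_gap (hφ : IsEntropyFunction φ) (h₁ : ConjStrictConvex φ)
    {q A η c σ : ℝ} (h : IsSubgradient (conj φ) q A) (hη : 0 < η) (hσ : 0 ≤ σ)
    (hr : (((conj φ q).toReal + A * η + c : ℝ) : EReal) ≤ conj φ (q + η))
    (hl : (((conj φ q).toReal - A * η + c : ℝ) : EReal) ≤ conj φ (q - η))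
    (hσA : |σ - A| * η < c) :
    0 ≤ σ * q - (conj φ q).toReal + η * |σ - A| ∧
      φ σ.toNNReal ≤ ENNReal.ofReal (σ * q - (conj φ q).toReal + η * |σ - A|) := by
  have hq := h.conj_ne_top hφ
  -- Since `|σ - A| η < c`, the tilted function `φ* - σ ·` is larger at both ends of the window than
  -- at `q`. By convexity its minimizer on the window is then global, so `σ ∈ ∂φ*(q')` with `q'`
  -- within `η` of `q`.
  obtain ⟨q', hq'mem, hmin⟩ := exists_minOn_Icc φ (c := fun r => -(σ * r)) (by fun_prop)
    (a := q - η) (b := q + η) (by linarith)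
  have hminq := hmin q ⟨by linarith, by linarith⟩
  have hq' : conj φ q' ≠ ⊤ := by
    intro hT
    rw [hT, EReal.coe_add_top, ← coe_toReal_conj hφ hq, ← EReal.coe_add, top_le_iff] at hminq
    exact EReal.coe_ne_top _ hminq
  have hreal : ∀ r, conj φ r ≠ ⊤ → r ∈ Set.Icc (q - η) (q + η) →
      -(σ * q') + (conj φ q').toReal ≤ -(σ * r) + (conj φ r).toReal := by
    intro r hrt hr'
    have := hmin r hr'
    rwa [← coe_toReal_conj hφ hq', ← coe_toReal_conj hφ hrt, ← EReal.coe_add, ← EReal.coe_add,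
      EReal.coe_le_coe_iff] at this
  have hqq := hreal q hq ⟨by linarith, by linarith⟩
  have habs := abs_le.1 (le_refl |σ - A|)
  have hsub : IsSubgradient (conj φ) q' σ := by
    refine isSubgradient_of_le hφ hq' fun r hrt => ?_
    rcases lt_or_ge r (q - η) with h1 | h1
    · have hd : 0 < q - r := by linarith
      have hlm : η / (q - r) * (q - r) = η := by field_simp
      set l := η / (q - r)
      have hl1 : l ≤ 1 := by by_contra! h; nlinarith
      have hl0 : 0 < l := by by_contra! h; nlinarith
      obtain ⟨k1, k2⟩ := h₁.toReal_le hq hrt hl0.le hl1 (show q - η = _ by linarith)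
      rw [← coe_toReal_conj hφ k1, EReal.coe_le_coe_iff] at hl
      by_contra! hcon
      nlinarith
    rcases lt_or_ge (q + η) r with h2 | h2
    · have hd : 0 < r - q := by linarith
      have hlm : η / (r - q) * (r - q) = η := by field_simp
      set l := η / (r - q)
      have hl1 : l ≤ 1 := by by_contra! h; nlinarith
      have hl0 : 0 < l := by by_contra! h; nlinarith
      obtain ⟨k1, k2⟩ := h₁.toReal_le hq hrt hl0.le hl1 (show q + η = _ by linarith)
      rw [← coe_toReal_conj hφ k1, EReal.coe_le_coe_iff] at hr
      by_contra! hcon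
      nlinarith
    · linarith [hreal r hrt ⟨h1, h2⟩]
  have hsub' : IsSubgradient (conj φ) q' (σ.toNNReal : ℝ) := by rwa [Real.coe_toNNReal _ hσ]
  have h0 := hsub.le hφ (y := 0) (by simp [conj_zero hφ])
  rw [toReal_conj_zero hφ] at h0
  have k := h.le hφ hq'
  have k' : (σ - A) * (q' - q) ≤ η * |σ - A| := by
    calc (σ - A) * (q' - q) ≤ |(σ - A) * (q' - q)| := le_abs_self _
      _ = |q' - q| * |σ - A| := by rw [abs_mul, mul_comm]
      _ ≤ _ := mul_le_mul_of_nonneg_right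
        (abs_le.2 ⟨by linarith [hq'mem.1], by linarith [hq'mem.2]⟩) (abs_nonneg _)
  -- Replacing `q'` by `q` costs at most `(σ - A)(q' - q)`, by the supporting line of slope `A` at
  -- `q`.
  have hle : σ * q' - (conj φ q').toReal ≤ σ * q - (conj φ q).toReal + η * |σ - A| := by
    nlinarith
  refine ⟨by linarith, (hsub'.apply_le hφ).trans (ENNReal.ofReal_le_ofReal ?_)⟩
  rwa [Real.coe_toNNReal _ hσ]

/-- The graph of the subdifferential of `φ*` is closed. -/
lemma isSubgradient_of_tendsto (hφ : IsEntropyFunction φ) {q s : ℕ → ℝ} {q₀ s₀ : ℝ}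
    (hq : Tendsto q atTop (𝓝 q₀)) (hs : Tendsto s atTop (𝓝 s₀))
    (h : ∀ n, IsSubgradient (conj φ) (q n) (s n)) : IsSubgradient (conj φ) q₀ s₀ := by
  have key : ∀ y, conj φ y ≠ ⊤ →
      conj φ q₀ ≤ (((conj φ y).toReal - s₀ * (y - q₀) : ℝ) : EReal) := by
    intro y hy
    refine conj_le fun p hp => ?_
    refine le_of_tendsto_of_tendsto' ((hq.const_mul (p : ℝ)).sub_const _)
      ((hs.mul (hq.const_sub y)).const_sub _) fun n => ?_
    have h1 := mul_sub_le_toReal_conj hφ hp ((h n).conj_ne_top hφ)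
    have h2 := (h n).le hφ hy
    linarith
  have hfin : conj φ q₀ ≠ ⊤ :=
    ne_top_of_le_ne_top (EReal.coe_ne_top _) (key 0 (by simp [conj_zero hφ]))
  refine isSubgradient_of_le hφ hfin fun y hy => ?_
  have := key y hy
  rw [← coe_toReal_conj hφ hfin, EReal.coe_le_coe_iff] at this
  linarith

/-- The two alternatives of assumption (2) merge into one: pairing `s n` with the slope `1` at `0`
gives slopes of arbitrarily small ratio. -/
lemma exists_slopes (hφ : IsEntropyFunction φ) (h₂ : ConjSlopesDegenerate φ) {κ : ℝ} (hκ : 0 < κ) :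
    ∃ x₁ s₁ x₂ s₂, IsSubgradient (conj φ) x₁ s₁ ∧ IsSubgradient (conj φ) x₂ s₂ ∧ 0 < s₂ ∧
      s₁ < κ * s₂ := by
  obtain ⟨x, s, hxs, h | h⟩ := h₂
  · obtain ⟨n, hn⟩ := (h.eventually (gt_mem_nhds hκ)).exists
    exact ⟨x n, s n, 0, 1, (hxs n).2, isSubgradient_zero_one hφ, one_pos, by simpa using hn⟩
  · obtain ⟨n, hn⟩ := (h.eventually (eventually_gt_atTop (1 / κ))).exists
    refine ⟨0, 1, x n, s n, isSubgradient_zero_one hφ, (hxs n).2,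
      (one_div_pos.2 hκ).trans hn, ?_⟩
    rwa [div_lt_iff₀ hκ, mul_comm] at hn

lemma continuous_cost_right {X : Type*} [TopologicalSpace X] {C : X → X → ℝ}
    (hC : Continuous fun z : X × X => C z.1 z.2) (x : X) :
    Continuous (C x) :=
  hC.comp (Continuous.prodMk_right x)

lemma exists_abs_le_of_continuous {X : Type*} [TopologicalSpace X] [CompactSpace X] {k : X → ℝ}
    (hk : Continuous k) : ∃ M, 0 ≤ M ∧ ∀ x, |k x| ≤ M := by
  obtain ⟨M, hM⟩ := isCompact_univ.exists_bound_of_continuousOn hk.continuousOn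
  exact ⟨max M 0, le_max_right _ _, fun x => (hM x (Set.mem_univ x)).trans (le_max_left _ _)⟩

/-! ### Integrals of continuous functions on a compact space -/

section Compact

variable {X : Type*} [TopologicalSpace X] [CompactSpace X] [MeasurableSpace X]
  [OpensMeasurableSpace X]

lemma integrable_of_continuous (μ : Measure X) [IsFiniteMeasure μ] {f : X → ℝ}
    (hf : Continuous f) : Integrable f μ :=
  hf.integrable_of_hasCompactSupport (HasCompactSupport.of_compactSpace f)

lemma integral_exp_lt (μ : Measure X) [IsFiniteMeasure μ] [NeZero μ] {ε δ : ℝ} (hε : 0 < ε)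
    {k l : X → ℝ} (hk : Continuous k) (hl : Continuous l) (hδ : 0 < δ)
    (hkl : ∀ y, k y + δ ≤ l y) :
    ∫ y, Real.exp (k y / ε) ∂μ < ∫ y, Real.exp (l y / ε) ∂μ := by
  have hpos : 0 < ∫ y, Real.exp (k y / ε) ∂μ :=
    integral_exp_pos (integrable_of_continuous μ (by fun_prop))
  calc ∫ y, Real.exp (k y / ε) ∂μ < Real.exp (δ / ε) * ∫ y, Real.exp (k y / ε) ∂μ :=
        lt_mul_of_one_lt_left hpos (Real.one_lt_exp_iff.2 (div_pos hδ hε))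
    _ = ∫ y, Real.exp (δ / ε) * Real.exp (k y / ε) ∂μ := (integral_const_mul _ _).symm
    _ ≤ ∫ y, Real.exp (l y / ε) ∂μ := by
        refine integral_mono (integrable_of_continuous μ (by fun_prop))
          (integrable_of_continuous μ (by fun_prop)) fun y => ?_
        simp only
        rw [← Real.exp_add, ← add_div]
        exact Real.exp_le_exp.2 (div_le_div_of_nonneg_right (by linarith [hkl y]) hε.le)

end Compact

/-! ### The Sinkhorn fixed point -/

section FixedPoint

variable {X : Type*} [MetricSpace X] [CompactSpace X] [MeasurableSpace X] [BorelSpace X]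
  {C : X → X → ℝ} {ε : ℝ}

/-- `v` is the best response to the potential `u`: the first-order optimality condition of
`v x = -aprox (-Smin_μ (C x · - u))`. -/
def IsSoftResponse (φ : ℝ≥0 → ℝ≥0∞) (C : X → X → ℝ) (ε : ℝ) (μ : Measure X) (u v : X → ℝ) : Prop :=
  ∀ x, IsSubgradient (conj φ) (-v x) (∫ y, Real.exp ((v x + u y - C x y) / ε) ∂μ)

/-- Identifies the slope in the optimality condition of `aprox` with the marginal density of the
plan. -/
lemma exp_softmin (hC : Continuous fun z : X × X => C z.1 z.2) (hε : 0 < ε) (μ : FiniteMeasure X)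
    (hμ : μ ≠ 0) {u : X → ℝ} (hu : Continuous u) (x : X) (v : ℝ) :
    Real.exp ((-softmin ε μ (fun y => C x y - u y) - -v) / ε) =
      ∫ y, Real.exp ((v + u y - C x y) / ε) ∂(μ : Measure X) := by
  have hCx := continuous_cost_right hC x
  have : NeZero (μ : Measure X) := ⟨fun h => hμ (FiniteMeasure.toMeasure_injective (by simpa using h))⟩
  have hpos : 0 < ∫ y, Real.exp (-(C x y - u y) / ε) ∂(μ : Measure X) :=
    integral_exp_pos (integrable_of_continuous _ (by fun_prop))
  have h1 : (-softmin ε μ (fun y => C x y - u y) - -v) / ε =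
      v / ε + Real.log (∫ y, Real.exp (-(C x y - u y) / ε) ∂(μ : Measure X)) := by
    rw [softmin]; field_simp; ring
  rw [h1, Real.exp_add, Real.exp_log hpos, ← integral_const_mul]
  congr 1
  ext y
  rw [← Real.exp_add]
  congr 1
  ring

lemma isSinkhornFixedPoint_iff (hC : Continuous fun z : X × X => C z.1 z.2)
    (hC_symm : ∀ x y, C x y = C y x) (hε : 0 < ε) (hφ : IsEntropyFunction φ)
    (h₁ : ConjStrictConvex φ) (α β : FiniteMeasure X) (hα : α ≠ 0) (hβ : β ≠ 0) {f g : X → ℝ}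
    (hf : Continuous f) (hg : Continuous g) :
    IsSinkhornFixedPoint φ C ε α β f g ↔
      IsSoftResponse φ C ε β g f ∧ IsSoftResponse φ C ε α f g := by
  have key : ∀ (μ : FiniteMeasure X), μ ≠ 0 → ∀ {u : X → ℝ} (v : X → ℝ), Continuous u →
      ((∀ x, IsAprox ε (conj φ) (-softmin ε μ (fun y => C x y - u y)) (-v x)) ↔
        IsSoftResponse φ C ε μ u v) := by
    intro μ hμ u v hu
    refine forall_congr' fun x => ?_
    rw [← exp_softmin hC hε μ hμ hu x (v x)]
    exact ⟨fun h => h.isSubgradient hφ h₁ hε, fun h => isAprox_of_isSubgradient hφ hε h⟩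
  rw [IsSinkhornFixedPoint, key β hβ f hg]
  simp_rw [hC_symm]
  rw [← key α hα g hf]

section Response

variable (μ : Measure X) [IsFiniteMeasure μ] [NeZero μ]

/-- If `v' x > v x`, the integral for `(u', v')` is strictly larger, while monotonicity of `∂φ*` at
`-v' x < -v x` orders the two slopes the other way. -/
lemma IsSoftResponse.antitone (hC : Continuous fun z : X × X => C z.1 z.2) (hε : 0 < ε)
    (hφ : IsEntropyFunction φ) {u v u' v' : X → ℝ} (hu : Continuous u) (hu' : Continuous u')
    (h : IsSoftResponse φ C ε μ u v) (h' : IsSoftResponse φ C ε μ u' v') (huu : u ≤ u') :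
    v' ≤ v := by
  intro x
  by_contra! hlt
  have hCx := continuous_cost_right hC x
  have h1 := (h' x).le_of_lt hφ (h x) (neg_lt_neg hlt)
  refine absurd (integral_exp_lt μ hε (δ := v' x - v x) ?_ ?_ (sub_pos.2 hlt) fun y => ?_)
    (not_lt.2 h1)
  · fun_prop
  · fun_prop
  · linarith [huu y]

lemma IsSoftResponse.unique (hC : Continuous fun z : X × X => C z.1 z.2) (hε : 0 < ε)
    (hφ : IsEntropyFunction φ) {u v v' : X → ℝ} (hu : Continuous u)
    (h : IsSoftResponse φ C ε μ u v) (h' : IsSoftResponse φ C ε μ u v') : v = v' :=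
  le_antisymm (h'.antitone μ hC hε hφ hu hu h le_rfl) (h.antitone μ hC hε hφ hu hu h' le_rfl)

/-- The comparison argument of `IsSoftResponse.antitone`, now between two points: an excess of `v`
beyond the variation of the cost would order integrals and slopes oppositely. -/
lemma IsSoftResponse.lipschitzWith {γ : ℝ} (hC : Continuous fun z : X × X => C z.1 z.2)
    (hC_lip : ∀ x y z, |C x z - C y z| ≤ γ * dist x y) (hε : 0 < ε)
    (hφ : IsEntropyFunction φ) {u v : X → ℝ} (hu : Continuous u)
    (h : IsSoftResponse φ C ε μ u v) : LipschitzWith γ.toNNReal v := by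
  refine LipschitzWith.of_le_add_mul _ fun x x' => ?_
  by_contra! hlt
  have hγ : γ * dist x x' ≤ γ.toNNReal * dist x x' :=
    mul_le_mul_of_nonneg_right (Real.le_coe_toNNReal γ) dist_nonneg
  have hCx := continuous_cost_right hC x
  have hCx' := continuous_cost_right hC x'
  have hpos : 0 ≤ γ.toNNReal * dist x x' := by positivity
  have h1 := (h x).le_of_lt hφ (h x') (by linarith)
  refine absurd (integral_exp_lt μ hε (δ := v x - (v x' + γ.toNNReal * dist x x')) ?_ ?_
    (sub_pos.2 hlt) fun y => ?_) (not_lt.2 h1)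
  · fun_prop
  · fun_prop
  · linarith [(abs_le.1 (hC_lip x x' y)).2]

lemma exists_isSoftResponse {γ : ℝ} (hC : Continuous fun z : X × X => C z.1 z.2)
    (hC_lip : ∀ x y z, |C x z - C y z| ≤ γ * dist x y) (hε : 0 < ε)
    (hφ : IsEntropyFunction φ) (h₁ : ConjStrictConvex φ) (u : C(X, ℝ)) :
    ∃ v : C(X, ℝ), IsSoftResponse φ C ε μ u v := by
  have hex : ∀ x, ∃ v : ℝ, IsSubgradient (conj φ) (-v)
      (∫ y, Real.exp ((v + u y - C x y) / ε) ∂μ) := by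
    intro x
    let ν : FiniteMeasure X := ⟨μ, inferInstance⟩
    have hν : ν ≠ 0 := fun h => NeZero.ne μ (congrArg FiniteMeasure.toMeasure h)
    obtain ⟨q, hq⟩ := exists_isAprox hφ hε (-softmin ε ν (fun y => C x y - u y))
    have := hq.isSubgradient hφ h₁ hε
    rw [← neg_neg q, exp_softmin hC hε ν hν u.continuous x (-q)] at this
    exact ⟨-q, this⟩
  choose v hv using hex
  have hresp : IsSoftResponse φ C ε μ u v := hv
  exact ⟨⟨v, (hresp.lipschitzWith μ hC hC_lip hε hφ u.continuous).continuous⟩, hresp⟩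

omit [NeZero μ] in
-- Pointwise convergence and upper bounds suffice: they dominate the exponentials, and the graph of
-- `∂φ*` is closed.
lemma isSoftResponse_of_tendsto (hC : Continuous fun z : X × X => C z.1 z.2) (hε : 0 < ε)
    (hφ : IsEntropyFunction φ) {u v : ℕ → X → ℝ} {u₀ v₀ : X → ℝ} {B : ℝ}
    (hu : ∀ n, Continuous (u n)) (huB : ∀ n y, u n y ≤ B) (hvB : ∀ n y, v n y ≤ B)
    (hu₀ : ∀ y, Tendsto (fun n => u n y) atTop (𝓝 (u₀ y)))
    (hv₀ : ∀ y, Tendsto (fun n => v n y) atTop (𝓝 (v₀ y)))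
    (h : ∀ n, IsSoftResponse φ C ε μ (u n) (v n)) : IsSoftResponse φ C ε μ u₀ v₀ := by
  intro x
  have hCx := continuous_cost_right hC x
  refine isSubgradient_of_tendsto hφ (hv₀ x).neg ?_ fun n => h n x
  refine tendsto_integral_of_dominated_convergence
    (fun y => Real.exp ((B + B - C x y) / ε)) (fun n => ?_)
    (integrable_of_continuous μ (by fun_prop)) (fun n => ae_of_all _ fun y => ?_)
    (ae_of_all _ fun y => ?_)
  · have := hu n
    exact Continuous.aestronglyMeasurable (by fun_prop)
  · rw [Real.norm_eq_abs, abs_of_pos (Real.exp_pos _)]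
    exact Real.exp_le_exp.2 (div_le_div_of_nonneg_right
      (by linarith [huB n y, hvB n x]) hε.le)
  · exact (Real.continuous_exp.tendsto _).comp
      ((((hv₀ x).add (hu₀ y)).sub_const _).div_const _)

end Response

variable (α β : Measure X) [IsFiniteMeasure α] [IsFiniteMeasure β] [NeZero α] [NeZero β]

/-- Large constants are supersolutions of the Sinkhorn map. -/
lemma exists_const_supersolution (hC : Continuous fun z : X × X => C z.1 z.2) (hε : 0 < ε)
    (hφ : IsEntropyFunction φ) (h₂ : ConjSlopesDegenerate φ) :
    ∃ a₀ : ℝ, ∀ a ≥ a₀, ∀ g f : X → ℝ, Continuous g → IsSoftResponse φ C ε α (fun _ => a) g →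
      IsSoftResponse φ C ε β g f → ∀ x, f x ≤ a := by
  obtain ⟨K, hK⟩ : ∃ K, ∀ z : X × X, |C z.1 z.2| ≤ K := by
    obtain ⟨K, -, hK⟩ := exists_abs_le_of_continuous hC
    exact ⟨K, hK⟩
  have hm : 0 < α.real Set.univ := measureReal_univ_pos
  have hn : 0 < β.real Set.univ := measureReal_univ_pos
  set m := α.real Set.univ
  set n := β.real Set.univ
  -- If `f x > a ≥ -x₁`, the slope at `-f x` is at most `s₁`. The response `g` to a large constant
  -- has slopes at least `s₂`, which forces the integral at `x` to be at least `κ s₂`, with `κ`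
  -- collecting the mass ratio and the oscillation of the cost; but `s₁ < κ s₂`.
  obtain ⟨x₁, s₁, x₂, s₂, hs₁, hs₂, hs₂pos, hlt⟩ :=
    exists_slopes hφ h₂ (κ := n / m * Real.exp (-(2 * K) / ε)) (by positivity)
  refine ⟨max (-x₁) (x₂ + K + ε * Real.log (s₂ / m)), fun a ha g f hg hgr hfr x => ?_⟩
  by_contra! hfa
  have ha1 := (le_max_left _ _).trans ha
  have ha2 := (le_max_right _ _).trans ha
  have hCx := continuous_cost_right hC x
  have hle := (hfr x).le_of_lt hφ hs₁ (by linarith)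
  -- Either `-g y > x₂` and slopes are monotone, or `g y ≥ -x₂` and `a` is large enough to bound the
  -- integrand directly.
  have hlow : ∀ y, s₂ ≤ ∫ z, Real.exp ((g y + a - C y z) / ε) ∂α := by
    intro y
    have hCy := continuous_cost_right hC y
    rcases lt_or_ge x₂ (-g y) with h | h
    · exact hs₂.le_of_lt hφ (hgr y) h
    · have h1 : s₂ / m ≤ Real.exp ((a - x₂ - K) / ε) := by
        rw [← Real.log_le_iff_le_exp (by positivity), le_div_iff₀ hε]
        linarith
      calc s₂ = ∫ _, s₂ / m ∂α := by
            rw [integral_const, smul_eq_mul, mul_div_cancel₀ _ hm.ne']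
        _ ≤ _ := by
            refine integral_mono (integrable_const _)
              (integrable_of_continuous α (by fun_prop)) fun z => h1.trans ?_
            exact Real.exp_le_exp.2 (div_le_div_of_nonneg_right
              (by linarith [(abs_le.1 (hK (y, z))).2]) hε.le)
  have hup : ∀ y, s₂ / m ≤ Real.exp ((g y + a + K) / ε) := by
    intro y
    have hCy := continuous_cost_right hC y
    rw [div_le_iff₀ hm]
    calc s₂ ≤ _ := hlow y
      _ ≤ ∫ _, Real.exp ((g y + a + K) / ε) ∂α := by
        refine integral_mono (integrable_of_continuous α (by fun_prop)) (integrable_const _)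
          fun z => ?_
        exact Real.exp_le_exp.2 (div_le_div_of_nonneg_right
          (by linarith [(abs_le.1 (hK (y, z))).1]) hε.le)
      _ = _ := by rw [integral_const, smul_eq_mul, mul_comm]
  have hfin : n / m * Real.exp (-(2 * K) / ε) * s₂ ≤
      ∫ y, Real.exp ((f x + g y - C x y) / ε) ∂β := by
    calc n / m * Real.exp (-(2 * K) / ε) * s₂
        = ∫ _, s₂ / m * Real.exp (-(2 * K) / ε) ∂β := by
          rw [integral_const, smul_eq_mul]; ring
      _ ≤ _ := by
        refine integral_mono (integrable_const _) (integrable_of_continuous β (by fun_prop))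
          fun y => ?_
        calc s₂ / m * Real.exp (-(2 * K) / ε)
            ≤ Real.exp ((g y + a + K) / ε) * Real.exp (-(2 * K) / ε) :=
              mul_le_mul_of_nonneg_right (hup y) (Real.exp_pos _).le
          _ = Real.exp ((g y + a - K) / ε) := by
              rw [← Real.exp_add]; congr 1; ring
          _ ≤ _ := Real.exp_le_exp.2 (div_le_div_of_nonneg_right
              (by linarith [(abs_le.1 (hK (x, y))).2]) hε.le)
  linarith

/-- Existence of a fixed point, by monotone iteration from a constant supersolution. -/
lemma exists_fixedPoint {γ : ℝ} (hC : Continuous fun z : X × X => C z.1 z.2)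
    (hC_lip : ∀ x y z, |C x z - C y z| ≤ γ * dist x y) (hε : 0 < ε)
    (hφ : IsEntropyFunction φ) (h₁ : ConjStrictConvex φ) (h₂ : ConjSlopesDegenerate φ) :
    ∃ f g : C(X, ℝ), IsSoftResponse φ C ε β g f ∧ IsSoftResponse φ C ε α f g := by
  choose S hS using exists_isSoftResponse α hC hC_lip hε hφ h₁
  choose T hT using exists_isSoftResponse β hC hC_lip hε hφ h₁
  have hSanti : ∀ u u' : C(X, ℝ), (∀ x, u x ≤ u' x) → ∀ x, S u' x ≤ S u x := fun u u' h =>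
    (hS u).antitone α hC hε hφ u.continuous u'.continuous (hS u') h
  have hTanti : ∀ u u' : C(X, ℝ), (∀ x, u x ≤ u' x) → ∀ x, T u' x ≤ T u x := fun u u' h =>
    (hT u).antitone β hC hε hφ u.continuous u'.continuous (hT u') h
  obtain ⟨a₀, ha₀⟩ := exists_const_supersolution α β hC hε hφ h₂
  obtain ⟨b₀, hb₀⟩ := exists_const_supersolution β α hC hε hφ h₂
  -- A subsolution: `b₀` is a supersolution of the exchanged problem, so `S w ≤ b₀`, and the
  -- antitone `T` gives `w ≤ T (S w)`.
  set w : C(X, ℝ) := T (ContinuousMap.const X b₀) with hw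
  have hwsub : ∀ x, w x ≤ T (S w) x := by
    refine hTanti _ _ fun x => ?_
    exact hb₀ b₀ le_rfl w (S w) w.continuous (hT _) (hS w) x
  obtain ⟨M, hM⟩ : ∃ M, ∀ x, w x ≤ M := by
    obtain ⟨M, -, hM⟩ := exists_abs_le_of_continuous w.continuous
    exact ⟨M, fun x => (le_abs_self _).trans (hM x)⟩
  -- Large enough both to be a supersolution and to lie above `w`, so that the iterates decrease and
  -- stay above `w`.
  set a := max a₀ M
  let F : ℕ → C(X, ℝ) := fun n => (fun u => T (S u))^[n] (ContinuousMap.const X a)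
  have hFsucc : ∀ n, F (n + 1) = T (S (F n)) := fun n => Function.iterate_succ_apply' _ _ _
  have hmono : ∀ u u' : C(X, ℝ), (∀ x, u x ≤ u' x) → ∀ x, T (S u) x ≤ T (S u') x :=
    fun u u' h => hTanti _ _ (hSanti _ _ h)
  have hdec : ∀ n x, F (n + 1) x ≤ F n x := by
    intro n
    induction n with
    | zero =>
      intro x
      rw [hFsucc]
      exact ha₀ a (le_max_left _ _) (S (F 0)) (T (S (F 0))) (S (F 0)).continuous (hS _) (hT _) x
    | succ n ih =>
      rw [hFsucc (n + 1), hFsucc n]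
      refine hmono _ _ fun x => ?_
      rw [← hFsucc n]
      exact ih x
  have hlow : ∀ n x, w x ≤ F n x := by
    intro n
    induction n with
    | zero => exact fun x => (hM x).trans (le_max_right _ _)
    | succ n ih =>
      intro x
      rw [hFsucc]
      exact (hwsub x).trans (hmono _ _ ih x)
  have hanti : ∀ x, Antitone fun n => F n x := fun x => antitone_nat_of_succ_le fun n => hdec n x
  have hFlim : ∀ x, ∃ l, Tendsto (fun n => F n x) atTop (𝓝 l) := fun x =>
    ⟨_, tendsto_atTop_ciInf (hanti x) ⟨w x, by rintro _ ⟨n, rfl⟩; exact hlow n x⟩⟩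
  choose f hf using hFlim
  have hGmono : ∀ x, Monotone fun n => S (F n) x := fun x =>
    monotone_nat_of_le_succ fun n => hSanti _ _ (hdec n) x
  have hGup : ∀ n x, S (F n) x ≤ S w x := fun n => hSanti _ _ (hlow n)
  have hGlim : ∀ x, ∃ l, Tendsto (fun n => S (F n) x) atTop (𝓝 l) := fun x =>
    ⟨_, tendsto_atTop_ciSup (hGmono x) ⟨S w x, by rintro _ ⟨n, rfl⟩; exact hGup n x⟩⟩
  choose g hg using hGlim
  obtain ⟨N, hN⟩ : ∃ N, ∀ x, S w x ≤ N := by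
    obtain ⟨N, -, hN⟩ := exists_abs_le_of_continuous (S w).continuous
    exact ⟨N, fun x => (le_abs_self _).trans (hN x)⟩
  have hFB : ∀ n x, F n x ≤ max a N := fun n x => (hanti x (Nat.zero_le n)).trans (le_max_left _ _)
  have hGB : ∀ n x, S (F n) x ≤ max a N := fun n x =>
    ((hGup n x).trans (hN x)).trans (le_max_right _ _)
  have hrg : IsSoftResponse φ C ε α f g :=
    isSoftResponse_of_tendsto α hC hε hφ (fun n => (F n).continuous) hFB hGB hf hg
      fun n => hS (F n)
  have hrf : IsSoftResponse φ C ε β g f :=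
    isSoftResponse_of_tendsto β hC hε hφ (fun n => (S (F n)).continuous) hGB
      (fun n x => hFB (n + 1) x) hg (fun x => (tendsto_add_atTop_iff_nat 1).2 (hf x))
      fun n => by rw [hFsucc]; exact hT _
  have hlipG : ∀ n, LipschitzWith γ.toNNReal (S (F n)) := fun n =>
    (hS (F n)).lipschitzWith α hC hC_lip hε hφ (F n).continuous
  -- The common Lipschitz constant passes to the pointwise limit, which supplies continuity.
  have hgl : LipschitzWith γ.toNNReal g := LipschitzWith.of_dist_le_mul fun x y =>
    le_of_tendsto ((hg x).dist (hg y)) (Eventually.of_forall fun n => (hlipG n).dist_le_mul x y)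
  have hfl := hrf.lipschitzWith β hC hC_lip hε hφ hgl.continuous
  exact ⟨⟨f, hfl.continuous⟩, ⟨g, hgl.continuous⟩, hrf, hrg⟩

/-- Uniqueness of the fixed point, by strict monotonicity. -/
lemma fixedPoint_unique (hC : Continuous fun z : X × X => C z.1 z.2)
    (hC_symm : ∀ x y, C x y = C y x) (hε : 0 < ε)
    (hφ : IsEntropyFunction φ) (h₁ : ConjStrictConvex φ) {f g f' g' : C(X, ℝ)}
    (hf : IsSoftResponse φ C ε β g f) (hg : IsSoftResponse φ C ε α f g)
    (hf' : IsSoftResponse φ C ε β g' f') (hg' : IsSoftResponse φ C ε α f' g') :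
    f = f' ∧ g = g' := by
  let E : X × X → ℝ := fun z => Real.exp ((f z.1 + g z.2 - C z.1 z.2) / ε)
  let E' : X × X → ℝ := fun z => Real.exp ((f' z.1 + g' z.2 - C z.1 z.2) / ε)
  have hEc : Continuous E := by fun_prop
  have hEc' : Continuous E' := by fun_prop
  have hA : ∀ x, 0 ≤ (∫ y, (E (x, y) - E' (x, y)) ∂β) * (f' x - f x) := by
    intro x
    have h := (hf x).mul_nonneg hφ (hf' x)
    rw [← integral_sub] at h
    · simpa [E, E', neg_add_eq_sub] using h
    · have hCx := continuous_cost_right hC x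
      exact integrable_of_continuous β (by fun_prop)
    · have hCx := continuous_cost_right hC x
      exact integrable_of_continuous β (by fun_prop)
  have hB : ∀ y, 0 ≤ (∫ x, (E (x, y) - E' (x, y)) ∂α) * (g' y - g y) := by
    intro y
    have h := (hg y).mul_nonneg hφ (hg' y)
    have hCy := continuous_cost_right hC y
    rw [← integral_sub] at h
    · have e : ∀ x, g y + f x - C y x = f x + g y - C x y := fun x => by rw [hC_symm y x]; ring
      have e' : ∀ x, g' y + f' x - C y x = f' x + g' y - C x y := fun x => by
        rw [hC_symm y x]; ring
      simp only [e, e'] at h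
      simpa [E, E', neg_add_eq_sub] using h
    · exact integrable_of_continuous α (by fun_prop)
    · exact integrable_of_continuous α (by fun_prop)
  have hI1 : 0 ≤ ∫ z, (E z - E' z) * (f' z.1 - f z.1) ∂(α.prod β) := by
    rw [integral_prod _ (integrable_of_continuous _ (by fun_prop))]
    refine integral_nonneg fun x => ?_
    simp only [integral_mul_const]
    exact hA x
  have hI2 : 0 ≤ ∫ z, (E z - E' z) * (g' z.2 - g z.2) ∂(α.prod β) := by
    rw [integral_prod_symm _ (integrable_of_continuous _ (by fun_prop))]
    refine integral_nonneg fun y => ?_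
    simp only [integral_mul_const]
    exact hB y
  have hsign : ∀ z : X × X, 0 ≤
      (E' z - E z) * ((f' z.1 + g' z.2) - (f z.1 + g z.2)) := by
    intro z
    rcases le_total (f z.1 + g z.2) (f' z.1 + g' z.2) with h | h
    · refine mul_nonneg (sub_nonneg.2 (Real.exp_le_exp.2 ?_)) (sub_nonneg.2 h)
      exact div_le_div_of_nonneg_right (by linarith) hε.le
    · refine mul_nonneg_of_nonpos_of_nonpos (sub_nonpos.2 (Real.exp_le_exp.2 ?_)) (sub_nonpos.2 h)
      exact div_le_div_of_nonneg_right (by linarith) hε.le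
  -- Monotonicity of the exponential makes this integral nonnegative; monotonicity of `∂φ*`,
  -- integrated in both variables, makes it nonpositive.
  have hI3 : ∫ z, (E' z - E z) * ((f' z.1 + g' z.2) - (f z.1 + g z.2)) ∂(α.prod β) = 0 := by
    refine le_antisymm ?_ (integral_nonneg hsign)
    have : ∫ z, (E' z - E z) * ((f' z.1 + g' z.2) - (f z.1 + g z.2)) ∂(α.prod β) =
        -(∫ z, (E z - E' z) * (f' z.1 - f z.1) ∂(α.prod β) +
          ∫ z, (E z - E' z) * (g' z.2 - g z.2) ∂(α.prod β)) := by
      rw [← integral_add (integrable_of_continuous _ (by fun_prop))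
        (integrable_of_continuous _ (by fun_prop)), ← integral_neg]
      congr 1
      ext z
      ring
    linarith
  have hae : ∀ᵐ z ∂(α.prod β), E z = E' z := by
    have h0 := (integral_eq_zero_iff_of_nonneg hsign
      (integrable_of_continuous _ (by fun_prop))).1 hI3
    filter_upwards [h0] with z hz
    rcases mul_eq_zero.1 hz with h | h
    · linarith
    · simp only [E, E', show f z.1 + g z.2 = f' z.1 + g' z.2 by linarith]
  -- Equal densities give equal slopes at `-f x` and `-f' x`; this rules out `f` and `f'` differing
  -- by a constant offset by `g` and `g'`.
  have haf : ∀ᵐ x ∂α, f x = f' x := by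
    filter_upwards [Measure.ae_ae_of_ae_prod hae] with x hx
    have hs := hf x
    rw [show (∫ y, Real.exp ((f x + g y - C x y) / ε) ∂β) =
      ∫ y, Real.exp ((f' x + g' y - C x y) / ε) ∂β from integral_congr_ae hx] at hs
    exact neg_injective (hs.eq_of_strictConvex hφ h₁ (hf' x))
  -- A response sees `f` only `α`-almost everywhere, so almost-everywhere equality of one potential
  -- gives equality everywhere of the other.
  have hgf' : IsSoftResponse φ C ε α f' g := by
    intro y
    have hs := hg y
    rwa [show (∫ x, Real.exp ((g y + f x - C y x) / ε) ∂α) =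
      ∫ x, Real.exp ((g y + f' x - C y x) / ε) ∂α from integral_congr_ae (by
        filter_upwards [haf] with x hx; rw [hx])] at hs
  have hgg : g = g' := DFunLike.coe_injective
    (hgf'.unique α hC hε hφ f'.continuous hg')
  subst hgg
  exact ⟨DFunLike.coe_injective (hf.unique β hC hε hφ g.continuous hf'), rfl⟩

end FixedPoint

/-! ### Bounds on the divergences -/

lemma ofReal_integral_le_lintegral {Y : Type*} [MeasurableSpace Y] {ν : Measure Y} {G : Y → ℝ}
    (hG : Integrable G ν) : ENNReal.ofReal (∫ y, G y ∂ν) ≤ ∫⁻ y, ENNReal.ofReal (G y) ∂ν := by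
  have h1 : ∫ y, G y ∂ν ≤ ∫ y, max (G y) 0 ∂ν :=
    integral_mono hG hG.pos_part fun y => le_max_left _ _
  refine (ENNReal.ofReal_le_ofReal h1).trans (le_of_eq ?_)
  rw [ofReal_integral_eq_lintegral_ofReal hG.pos_part (ae_of_all _ fun y => le_max_right _ _)]
  simp

lemma csiszarDiv_of_ac {Y : Type*} [MeasurableSpace Y] {μ ν : Measure Y} (h : μ ≪ ν) :
    csiszarDiv φ μ ν = ∫⁻ y, φ (μ.rnDeriv ν y).toNNReal ∂ν := by
  simp [csiszarDiv, Measure.singularPart_eq_zero_of_ac h]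

section Bounds

variable {X : Type*} [TopologicalSpace X] [CompactSpace X] [MeasurableSpace X]
  [OpensMeasurableSpace X]

/-- Fenchel–Young applied to the density and integrated. Absolute continuity removes the recession
term. -/
lemma le_csiszarDiv (hφ : IsEntropyFunction φ) {μ ν : Measure X} [IsFiniteMeasure μ]
    [IsFiniteMeasure ν] (h : μ ≪ ν) {k : X → ℝ} (hk : Continuous k)
    (hfin : ∀ x, conj φ (k x) ≠ ⊤) (hcont : Continuous fun x => (conj φ (k x)).toReal) :
    ENNReal.ofReal (∫ x, k x ∂μ - ∫ x, (conj φ (k x)).toReal ∂ν) ≤ csiszarDiv φ μ ν := by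
  have hint : Integrable (fun x => (μ.rnDeriv ν x).toReal * k x) ν := by
    simpa using (integrable_rnDeriv_smul_iff h (f := k)).2 (integrable_of_continuous μ hk)
  rw [csiszarDiv_of_ac h, ← integral_toReal_rnDeriv_mul h,
    ← integral_sub hint (integrable_of_continuous ν hcont)]
  refine (ofReal_integral_le_lintegral
    (hint.sub (integrable_of_continuous ν hcont))).trans (lintegral_mono fun x => ?_)
  by_cases hx : φ (μ.rnDeriv ν x).toNNReal = ⊤
  · simp [hx]
  · refine ENNReal.ofReal_le_of_le_toReal ?_
    have := mul_sub_le_toReal_conj hφ hx (hfin x)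
    rw [ENNReal.coe_toNNReal_eq_toReal] at this
    simp only [Pi.sub_apply]
    linarith

lemma csiszarDiv_withDensity_le {ν : Measure X} [IsFiniteMeasure ν] {A b : X → ℝ}
    (hA : Continuous A) (hb : Continuous b) (hb0 : ∀ x, 0 ≤ b x)
    (hAb : ∀ x, φ (A x).toNNReal ≤ ENNReal.ofReal (b x)) :
    csiszarDiv φ (ν.withDensity fun x => ENNReal.ofReal (A x)) ν ≤
      ENNReal.ofReal (∫ x, b x ∂ν) := by
  rw [csiszarDiv_of_ac (withDensity_absolutelyContinuous _ _),
    ofReal_integral_eq_lintegral_ofReal (integrable_of_continuous ν hb) (ae_of_all _ hb0)]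
  refine lintegral_mono_ae ?_
  filter_upwards [Measure.rnDeriv_withDensity ν (hA.measurable.ennreal_ofReal)] with x hx
  rw [hx, ENNReal.ofReal, ENNReal.toNNReal_coe]
  exact hAb x

/-- The Fenchel–Young inequality between `r log r + 1 - r` and `exp t - 1`, integrated; pointwise it
is `1 + x ≤ exp x` at `x = t - log r`. -/
lemma le_klDiv {μ ν : Measure X} [IsFiniteMeasure μ] [IsFiniteMeasure ν] (h : μ ≪ ν) {t : X → ℝ}
    (ht : Continuous t) :
    ENNReal.ofReal (∫ x, t x ∂μ - ∫ x, (Real.exp (t x) - 1) ∂ν) ≤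
      InformationTheory.klDiv μ ν := by
  have hint : Integrable (fun x => (μ.rnDeriv ν x).toReal * t x) ν := by
    simpa using (integrable_rnDeriv_smul_iff h (f := t)).2 (integrable_of_continuous μ ht)
  have hint' : Integrable (fun x => Real.exp (t x) - 1) ν :=
    integrable_of_continuous ν (by fun_prop)
  rw [InformationTheory.klDiv_eq_lintegral_klFun_of_ac h, ← integral_toReal_rnDeriv_mul h,
    ← integral_sub hint hint']
  refine (ofReal_integral_le_lintegral (hint.sub hint')).trans
    (lintegral_mono fun x => ENNReal.ofReal_le_ofReal ?_)
  rw [InformationTheory.klFun_apply, Pi.sub_apply]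
  rcases (ENNReal.toReal_nonneg (a := μ.rnDeriv ν x)).eq_or_lt with h0 | h0
  · simp [← h0, (Real.exp_pos (t x)).le]
  · set r := (μ.rnDeriv ν x).toReal
    have h1 : r * (t x - Real.log r + 1) ≤ Real.exp (t x) := by
      calc r * (t x - Real.log r + 1) ≤ r * Real.exp (t x - Real.log r) :=
            mul_le_mul_of_nonneg_left (Real.add_one_le_exp _) h0.le
        _ = Real.exp (t x) := by rw [Real.exp_sub, Real.exp_log h0]; field_simp
    linarith

lemma klDiv_withDensity_exp {ν : Measure X} [IsFiniteMeasure ν] {t : X → ℝ} (ht : Continuous t)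
    [IsFiniteMeasure (ν.withDensity fun x => ENNReal.ofReal (Real.exp (t x)))] :
    InformationTheory.klDiv (ν.withDensity fun x => ENNReal.ofReal (Real.exp (t x))) ν =
      ENNReal.ofReal (∫ x, (Real.exp (t x) * t x + 1 - Real.exp (t x)) ∂ν) := by
  rw [InformationTheory.klDiv_eq_lintegral_klFun_of_ac (withDensity_absolutelyContinuous _ _),
    ofReal_integral_eq_lintegral_ofReal (integrable_of_continuous ν (by fun_prop))]
  · refine lintegral_congr_ae ?_
    filter_upwards [Measure.rnDeriv_withDensity ν
      (show Measurable fun x => ENNReal.ofReal (Real.exp (t x)) from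
        (Real.continuous_exp.comp ht).measurable.ennreal_ofReal)] with x hx
    rw [hx, ENNReal.toReal_ofReal (Real.exp_pos _).le, InformationTheory.klFun_apply,
      Real.log_exp]
  · refine ae_of_all _ fun x => ?_
    have := InformationTheory.klFun_nonneg (Real.exp_pos (t x)).le
    rwa [InformationTheory.klFun_apply, Real.log_exp] at this

end Bounds

/-! ### Marginals of a plan with density -/

section Marginals

variable {X Y : Type*} [MeasurableSpace X] [MeasurableSpace Y]

lemma fst_withDensity_prod (α : Measure X) (β : Measure Y) [SFinite α] [SFinite β]
    {E : X × Y → ℝ≥0∞} (hE : Measurable E) :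
    ((α.prod β).withDensity E).fst = α.withDensity fun x => ∫⁻ y, E (x, y) ∂β := by
  ext s hs
  rw [Measure.fst_apply hs, withDensity_apply _ (measurable_fst hs), withDensity_apply _ hs,
    ← Set.prod_univ, ← Measure.prod_restrict, Measure.restrict_univ, lintegral_prod _ hE.aemeasurable]

lemma snd_withDensity_prod (α : Measure X) (β : Measure Y) [SFinite α] [SFinite β]
    {E : X × Y → ℝ≥0∞} (hE : Measurable E) :
    ((α.prod β).withDensity E).snd = β.withDensity fun y => ∫⁻ x, E (x, y) ∂α := by
  ext s hs
  rw [Measure.snd_apply hs, withDensity_apply _ (measurable_snd hs), withDensity_apply _ hs,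
    ← Set.univ_prod, ← Measure.prod_restrict, Measure.restrict_univ,
    lintegral_prod_symm _ hE.aemeasurable]

end Marginals

/-! ### The transport cost at near-optimal potentials -/

/-- The dual functional, for potentials along which `φ*` is finite, as a real number. -/
noncomputable def dualValue {X : Type*} [MeasurableSpace X] (φ : ℝ≥0 → ℝ≥0∞) (C : X → X → ℝ)
    (ε : ℝ) (α β : Measure X) (f g : X → ℝ) : ℝ :=
  -∫ x, (conj φ (-f x)).toReal ∂α - ∫ y, (conj φ (-g y)).toReal ∂β -
    ε * ∫ z, (Real.exp ((f z.1 + g z.2 - C z.1 z.2) / ε) - 1) ∂(α.prod β)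

section Transport

variable {X : Type*} [MetricSpace X] [CompactSpace X] [MeasurableSpace X] [BorelSpace X]
  {C : X → X → ℝ} {ε : ℝ}

/-- Weak duality. -/
lemma dualValue_le_OT (hC : Continuous fun z : X × X => C z.1 z.2) (hε : 0 < ε)
    (hφ : IsEntropyFunction φ) (α β : FiniteMeasure X) {f g : X → ℝ}
    (hf : Continuous f) (hg : Continuous g)
    (hf_fin : ∀ x, conj φ (-f x) ≠ ⊤) (hg_fin : ∀ y, conj φ (-g y) ≠ ⊤)
    (hf_cont : Continuous fun x => (conj φ (-f x)).toReal)
    (hg_cont : Continuous fun y => (conj φ (-g y)).toReal) :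
    (dualValue φ C ε α β f g : EReal) ≤ OT φ C ε α β := by
  refine le_iInf fun π => ?_
  -- Otherwise the entropic term is infinite. In the remaining case the marginals of `π` are
  -- absolutely continuous too.
  by_cases hac : (π : Measure (X × X)) ≪ (α : Measure X).prod (β : Measure X)
  swap
  · rw [InformationTheory.klDiv_of_not_ac hac, ENNReal.mul_top (by simpa using hε), add_top,
      EReal.coe_ennreal_top, EReal.coe_add_top]
    exact le_top
  have hac1 : (π : Measure (X × X)).fst ≪ (α : Measure X) := by
    refine (hac.map measurable_fst).trans ?_
    rw [Measure.map_fst_prod]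
    exact Measure.smul_absolutelyContinuous
  have hac2 : (π : Measure (X × X)).snd ≪ (β : Measure X) := by
    refine (hac.map measurable_snd).trans ?_
    rw [Measure.map_snd_prod]
    exact Measure.smul_absolutelyContinuous
  have h1 := le_csiszarDiv hφ hac1 hf.neg hf_fin hf_cont
  have h2 := le_csiszarDiv hφ hac2 hg.neg hg_fin hg_cont
  have h3 := le_klDiv hac (t := fun z => (f z.1 + g z.2 - C z.1 z.2) / ε) (by fun_prop)
  have h4 := mul_le_mul_right h3 (ENNReal.ofReal ε)
  rw [← ENNReal.ofReal_mul hε.le] at h4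
  have h5 := add_le_add (add_le_add h1 h2) h4
  set S := csiszarDiv φ (π : Measure (X × X)).fst (α : Measure X) +
    csiszarDiv φ (π : Measure (X × X)).snd (β : Measure X) +
    ENNReal.ofReal ε * InformationTheory.klDiv (π : Measure (X × X))
      ((α : Measure X).prod (β : Measure X))
  by_cases hS : S = ⊤
  · rw [hS, EReal.coe_ennreal_top, EReal.coe_add_top]
    exact le_top
  rw [← EReal.coe_ennreal_toReal hS, ← EReal.coe_add, EReal.coe_le_coe_iff]
  have h6 := (ENNReal.ofReal_le_iff_le_toReal hS).1
    ((ENNReal.ofReal_add_le.trans (add_le_add_left ENNReal.ofReal_add_le _)).trans h5)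
  have e1 : ∫ x, (-f) x ∂(π : Measure (X × X)).fst = ∫ z, -f z.1 ∂(π : Measure (X × X)) :=
    integral_map measurable_fst.aemeasurable hf.neg.aestronglyMeasurable
  have e2 : ∫ x, (-g) x ∂(π : Measure (X × X)).snd = ∫ z, -g z.2 ∂(π : Measure (X × X)) :=
    integral_map measurable_snd.aemeasurable hg.neg.aestronglyMeasurable
  have e3 : ∫ z, C z.1 z.2 ∂(π : Measure (X × X)) + (∫ z, -f z.1 ∂(π : Measure (X × X)) +
      ∫ z, -g z.2 ∂(π : Measure (X × X)) +
      ε * ∫ z, (f z.1 + g z.2 - C z.1 z.2) / ε ∂(π : Measure (X × X))) = 0 := by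
    rw [← integral_const_mul, ← integral_add (integrable_of_continuous _ (by fun_prop))
      (integrable_of_continuous _ (by fun_prop)),
      ← integral_add (integrable_of_continuous _ (by fun_prop))
      (integrable_of_continuous _ (by fun_prop)),
      ← integral_add (integrable_of_continuous _ (by fun_prop))
      (integrable_of_continuous _ (by fun_prop))]
    rw [← integral_zero (X × X) ℝ (μ := (π : Measure (X × X)))]
    congr 1
    ext z
    field_simp
    ring
  rw [e1, e2] at h6
  simp only [Pi.neg_apply] at h6
  rw [dualValue]
  linarith

lemma continuous_integral_right {Y : Type*} [MetricSpace Y] [LocallyCompactSpace Y]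
    (ν : Measure X) [IsFiniteMeasure ν]
    {E : Y × X → ℝ} (hE : Continuous E) :
    Continuous fun x => ∫ y, E (x, y) ∂ν := by
  have := continuous_parametric_integral_of_continuous (μ := ν) (f := fun x y => E (x, y))
    (by simpa [Function.uncurry_def] using hE) isCompact_univ
  simpa using this

/-- The plan with density `exp ((f ⊕ g - C) / ε)` almost attains the dual value as soon as its
marginals are almost in Fenchel duality with `-f` and `-g`. -/
lemma OT_le_dualValue_add (hC : Continuous fun z : X × X => C z.1 z.2) (hε : 0 < ε)
    (α β : FiniteMeasure X) {f g : X → ℝ}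
    (hf : Continuous f) (hg : Continuous g)
    (hf_cont : Continuous fun x => (conj φ (-f x)).toReal)
    (hg_cont : Continuous fun y => (conj φ (-g y)).toReal) {κ : ℝ} {A B : X → ℝ}
    (hA : ∀ x, A x = ∫ y, Real.exp ((f x + g y - C x y) / ε) ∂(β : Measure X))
    (hB : ∀ y, B y = ∫ x, Real.exp ((f x + g y - C x y) / ε) ∂(α : Measure X))
    (hA0 : ∀ x, 0 ≤ A x * -f x - (conj φ (-f x)).toReal + κ)
    (hB0 : ∀ y, 0 ≤ B y * -g y - (conj φ (-g y)).toReal + κ)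
    (hφA : ∀ x, φ (A x).toNNReal ≤ ENNReal.ofReal (A x * -f x - (conj φ (-f x)).toReal + κ))
    (hφB : ∀ y, φ (B y).toNNReal ≤ ENNReal.ofReal (B y * -g y - (conj φ (-g y)).toReal + κ)) :
    OT φ C ε α β ≤ ((dualValue φ C ε α β f g +
      κ * ((α : Measure X).real Set.univ + (β : Measure X).real Set.univ) : ℝ) : EReal) := by
  set t : X × X → ℝ := fun z => (f z.1 + g z.2 - C z.1 z.2) / ε with ht
  have htc : Continuous t := by fun_prop
  set ρ := (α : Measure X).prod (β : Measure X) with hρ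
  have hEm : Measurable fun z => ENNReal.ofReal (Real.exp (t z)) :=
    (Real.continuous_exp.comp htc).measurable.ennreal_ofReal
  have hEint : Integrable (fun z => Real.exp (t z)) ρ := integrable_of_continuous ρ (by fun_prop)
  have hfin : IsFiniteMeasure (ρ.withDensity fun z => ENNReal.ofReal (Real.exp (t z))) :=
    isFiniteMeasure_withDensity_ofReal hEint.2
  have hAc : Continuous A := by
    rw [funext hA]
    exact continuous_integral_right (β : Measure X) (E := fun z => Real.exp (t z)) (by fun_prop)
  have hBc : Continuous B := by
    rw [funext hB]
    exact continuous_integral_right (α : Measure X) (E := fun z => Real.exp (t (z.2, z.1)))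
      (by fun_prop)
  have hCx := continuous_cost_right hC
  have hCy : ∀ y, Continuous fun x => C x y := fun y => hC.comp (Continuous.prodMk_left y)
  have hfst : (ρ.withDensity fun z => ENNReal.ofReal (Real.exp (t z))).fst =
      (α : Measure X).withDensity fun x => ENNReal.ofReal (A x) := by
    rw [hρ, fst_withDensity_prod _ _ hEm]
    congr 1
    ext x
    rw [hA, ofReal_integral_eq_lintegral_ofReal]
    · have := hCx x
      exact integrable_of_continuous _ (by fun_prop)
    · exact ae_of_all _ fun y => (Real.exp_pos _).le
  have hsnd : (ρ.withDensity fun z => ENNReal.ofReal (Real.exp (t z))).snd =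
      (β : Measure X).withDensity fun x => ENNReal.ofReal (B x) := by
    rw [hρ, snd_withDensity_prod _ _ hEm]
    congr 1
    ext y
    rw [hB, ofReal_integral_eq_lintegral_ofReal]
    · have := hCy y
      exact integrable_of_continuous _ (by fun_prop)
    · exact ae_of_all _ fun y => (Real.exp_pos _).le
  refine (iInf_le _ ⟨ρ.withDensity fun z => ENNReal.ofReal (Real.exp (t z)), hfin⟩).trans ?_
  simp only [FiniteMeasure.toMeasure_mk]
  rw [hfst, hsnd, ← hρ, klDiv_withDensity_exp htc, ← ENNReal.ofReal_mul hε.le]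
  have h1 := csiszarDiv_withDensity_le (ν := (α : Measure X)) hAc (by fun_prop) hA0 hφA
  have h2 := csiszarDiv_withDensity_le (ν := (β : Measure X)) hBc (by fun_prop) hB0 hφB
  have hkl : 0 ≤ ∫ z, (Real.exp (t z) * t z + 1 - Real.exp (t z)) ∂ρ := by
    refine integral_nonneg fun z => ?_
    have := InformationTheory.klFun_nonneg (Real.exp_pos (t z)).le
    rwa [InformationTheory.klFun_apply, Real.log_exp] at this
  have h3 := add_le_add_left (add_le_add h1 h2)
    (ENNReal.ofReal (ε * ∫ z, (Real.exp (t z) * t z + 1 - Real.exp (t z)) ∂ρ))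
  have hI1 : 0 ≤ ∫ x, (A x * -f x - (conj φ (-f x)).toReal + κ) ∂(α : Measure X) :=
    integral_nonneg hA0
  have hI2 : 0 ≤ ∫ y, (B y * -g y - (conj φ (-g y)).toReal + κ) ∂(β : Measure X) :=
    integral_nonneg hB0
  rw [← ENNReal.ofReal_add hI1 hI2,
    ← ENNReal.ofReal_add (add_nonneg hI1 hI2) (mul_nonneg hε.le hkl)] at h3
  refine (add_le_add_right (EReal.coe_ennreal_le_coe_ennreal_iff.2 h3) _).trans ?_
  rw [EReal.coe_ennreal_ofReal, max_eq_left
    (add_nonneg (add_nonneg hI1 hI2) (mul_nonneg hε.le hkl)), ← EReal.coe_add,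
    EReal.coe_le_coe_iff]
  have e1 : ∫ z, C z.1 z.2 ∂(ρ.withDensity fun z => ENNReal.ofReal (Real.exp (t z))) =
      ∫ z, Real.exp (t z) * C z.1 z.2 ∂ρ := by
    rw [integral_withDensity_eq_integral_toReal_smul hEm (ae_of_all _ fun _ => ENNReal.ofReal_lt_top)]
    simp only [ENNReal.toReal_ofReal (Real.exp_pos _).le, smul_eq_mul]
  have e2 : ∫ x, (A x * -f x - (conj φ (-f x)).toReal + κ) ∂(α : Measure X) =
      ∫ z, Real.exp (t z) * -f z.1 ∂ρ - ∫ x, (conj φ (-f x)).toReal ∂(α : Measure X) +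
        κ * (α : Measure X).real Set.univ := by
    rw [integral_add (integrable_of_continuous _ (by fun_prop)) (integrable_const _),
      integral_sub (integrable_of_continuous _ (by fun_prop))
        (integrable_of_continuous _ hf_cont), integral_const, smul_eq_mul, mul_comm κ, hρ,
      integral_prod _ (integrable_of_continuous _ (by fun_prop))]
    simp only [integral_mul_const, hA, ht]
  have e3 : ∫ y, (B y * -g y - (conj φ (-g y)).toReal + κ) ∂(β : Measure X) =
      ∫ z, Real.exp (t z) * -g z.2 ∂ρ - ∫ x, (conj φ (-g x)).toReal ∂(β : Measure X) +
        κ * (β : Measure X).real Set.univ := by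
    rw [integral_add (integrable_of_continuous _ (by fun_prop)) (integrable_const _),
      integral_sub (integrable_of_continuous _ (by fun_prop))
        (integrable_of_continuous _ hg_cont), integral_const, smul_eq_mul, mul_comm κ, hρ,
      integral_prod_symm _ (integrable_of_continuous _ (by fun_prop))]
    simp only [integral_mul_const, hB, ht]
  -- Since `ε t = f ⊕ g - C`, the transport, potential and logarithmic terms cancel pointwise; only
  -- the mass terms remain.
  have e4 : ∫ z, Real.exp (t z) * C z.1 z.2 ∂ρ + (∫ z, Real.exp (t z) * -f z.1 ∂ρ +
      ∫ z, Real.exp (t z) * -g z.2 ∂ρ +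
      ε * ∫ z, (Real.exp (t z) * t z + 1 - Real.exp (t z)) ∂ρ) =
      -(ε * ∫ z, (Real.exp (t z) - 1) ∂ρ) := by
    rw [← integral_const_mul, ← integral_const_mul, ← integral_neg,
      ← integral_add (integrable_of_continuous _ (by fun_prop))
      (integrable_of_continuous _ (by fun_prop)),
      ← integral_add (integrable_of_continuous _ (by fun_prop))
      (integrable_of_continuous _ (by fun_prop)),
      ← integral_add (integrable_of_continuous _ (by fun_prop))
      (integrable_of_continuous _ (by fun_prop))]
    congr 1
    ext z
    have : ε * t z = f z.1 + g z.2 - C z.1 z.2 := by rw [ht]; field_simp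
    linear_combination Real.exp (t z) * this
  rw [e1, e2, e3, dualValue]
  linarith

end Transport

/-! ### Consequences of the optimality conditions -/

/-- Subtracting the supporting line leaves a local minimum at `q`, so the derivative there equals
the slope. -/
lemma IsSubgradient.hasFiniteDerivAt (hφ : IsEntropyFunction φ) {q s d : ℝ}
    (h : IsSubgradient (conj φ) q s) (hd : HasFiniteDerivAt (conj φ) d q) :
    HasFiniteDerivAt (conj φ) s q := by
  obtain ⟨h₀, heq, hder⟩ := hd
  have hmin : IsLocalMin (fun r => h₀ r - s * (r - q)) q := by
    filter_upwards [heq] with r hr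
    have h1 := h.le hφ (y := r) (by rw [hr]; exact EReal.coe_ne_top _)
    rw [hr, heq.self_of_nhds, EReal.toReal_coe, EReal.toReal_coe] at h1
    simp only [sub_self, mul_zero, sub_zero]
    linarith
  have hder' : HasDerivAt (fun r => h₀ r - s * (r - q)) (d - s * 1) q :=
    hder.sub (((hasDerivAt_id q).sub_const q).const_mul s)
  have : d = s := by linarith [hmin.hasDerivAt_eq_zero hder']
  exact ⟨h₀, heq, this ▸ hder⟩

/-- Near `x₀` the value is squeezed between the supporting lines based at `v x₀` and at `v x`.
Continuity of the slopes makes this work even at the boundary of the domain. -/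
lemma continuous_toReal_conj {X : Type*} [TopologicalSpace X] (hφ : IsEntropyFunction φ)
    {v A : X → ℝ} (hv : Continuous v) (hA : Continuous A)
    (h : ∀ x, IsSubgradient (conj φ) (v x) (A x)) :
    Continuous fun x => (conj φ (v x)).toReal := by
  refine continuous_iff_continuousAt.2 fun x₀ => ?_
  refine tendsto_of_tendsto_of_tendsto_of_le_of_le
    (g := fun x => (conj φ (v x₀)).toReal + A x₀ * (v x - v x₀))
    (h := fun x => (conj φ (v x₀)).toReal - A x * (v x₀ - v x)) ?_ ?_
    (fun x => (h x₀).le hφ ((h x).conj_ne_top hφ)) fun x => ?_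
  · exact (show Continuous fun x => (conj φ (v x₀)).toReal + A x₀ * (v x - v x₀) by
      fun_prop).tendsto' x₀ _ (by simp)
  · exact (show Continuous fun x => (conj φ (v x₀)).toReal - A x * (v x₀ - v x) by
      fun_prop).tendsto' x₀ _ (by simp)
  · have := (h x).le hφ ((h x₀).conj_ne_top hφ)
    linarith

/-- Strict convexity gives a positive gap at each point, lower semicontinuity of `φ*` makes it
locally uniform, and compactness makes it global. -/
lemma exists_uniform_gap {X : Type*} [TopologicalSpace X] [CompactSpace X]
    (hφ : IsEntropyFunction φ) (h₁ : ConjStrictConvex φ) {v A : X → ℝ} (hv : Continuous v)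
    (hA : Continuous A) (h : ∀ x, IsSubgradient (conj φ) (v x) (A x)) {η : ℝ} (hη : η ≠ 0) :
    ∃ c > 0, ∀ x, (((conj φ (v x)).toReal + A x * η + c : ℝ) : EReal) ≤ conj φ (v x + η) := by
  have hcont := continuous_toReal_conj hφ hv hA h
  suffices H : ∃ c > 0, ∀ x ∈ (Set.univ : Set X),
      (((conj φ (v x)).toReal + A x * η + c : ℝ) : EReal) ≤ conj φ (v x + η) by simpa using H
  refine isCompact_univ.induction_on
    (p := fun s => ∃ c > 0, ∀ x ∈ s,
      (((conj φ (v x)).toReal + A x * η + c : ℝ) : EReal) ≤ conj φ (v x + η))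
    ⟨1, one_pos, by simp⟩ ?_ ?_ ?_
  · rintro s t hst ⟨c, hc, H⟩
    exact ⟨c, hc, fun x hx => H x (hst hx)⟩
  · rintro s t ⟨c, hc, H⟩ ⟨c', hc', H'⟩
    refine ⟨min c c', lt_min hc hc', fun x hx => ?_⟩
    rcases hx with hx | hx
    · refine le_trans (EReal.coe_le_coe_iff.2 ?_) (H x hx)
      linarith [min_le_left c c']
    · refine le_trans (EReal.coe_le_coe_iff.2 ?_) (H' x hx)
      linarith [min_le_right c c']
  · intro x₀ _
    obtain ⟨w, hw1, hw2⟩ := EReal.lt_iff_exists_real_btwn.1 ((h x₀).lt_conj hφ h₁ hη)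
    rw [EReal.coe_lt_coe_iff] at hw1
    set c := (w - ((conj φ (v x₀)).toReal + A x₀ * η)) / 2 with hc
    have hcpos : 0 < c := by rw [hc]; linarith
    have e1 : ∀ᶠ x in 𝓝 x₀, (w : EReal) < conj φ (v x + η) :=
      (show Continuous fun x => v x + η by fun_prop).continuousAt.eventually
        (lowerSemicontinuous_conj φ (v x₀ + η) w hw2)
    have e2 : ∀ᶠ x in 𝓝 x₀, (conj φ (v x)).toReal + A x * η + c < w :=
      (show Continuous fun x => (conj φ (v x)).toReal + A x * η + c by fun_prop).continuousAt.eventually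
        (gt_mem_nhds (by rw [hc]; linarith))
    refine ⟨_, mem_nhdsWithin_of_mem_nhds (e1.and e2), c, hcpos, ?_⟩
    rintro x ⟨hx1, hx2⟩
    exact (EReal.coe_le_coe_iff.2 hx2.le).trans hx1.le

/-- Uniform stability of the equality case of the Fenchel--Young inequality. -/
lemma exists_uniform_stability {X : Type*} [TopologicalSpace X] [CompactSpace X]
    (hφ : IsEntropyFunction φ) (h₁ : ConjStrictConvex φ) {v A : X → ℝ} (hv : Continuous v)
    (hA : Continuous A) (h : ∀ x, IsSubgradient (conj φ) (v x) (A x)) {η : ℝ} (hη : 0 < η) :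
    ∃ τ > 0, ∀ x σ, 0 ≤ σ → |σ - A x| < τ →
      0 ≤ σ * v x - (conj φ (v x)).toReal + η * |σ - A x| ∧
      φ σ.toNNReal ≤ ENNReal.ofReal (σ * v x - (conj φ (v x)).toReal + η * |σ - A x|) := by
  obtain ⟨c, hc, H⟩ := exists_uniform_gap hφ h₁ hv hA h hη.ne'
  obtain ⟨c', hc', H'⟩ := exists_uniform_gap hφ h₁ hv hA h (neg_ne_zero.2 hη.ne')
  refine ⟨min c c' / η, div_pos (lt_min hc hc') hη, fun x σ hσ hσA => ?_⟩
  rw [lt_div_iff₀ hη] at hσA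
  refine (h x).apply_le_of_gap hφ h₁ hη hσ
    (le_trans (EReal.coe_le_coe_iff.2 ?_) (H x)) (le_trans (EReal.coe_le_coe_iff.2 ?_) (H' x)) hσA
  · linarith [min_le_left c c']
  · linarith [min_le_right c c']

/-! ### Signed measures -/

section Signed

variable {X : Type*} [MeasurableSpace X]

/-- The Jordan decomposition turns the hypothesis into an identity of positive measures once
negative terms change sides; which ones do depends on the sign of `t`. -/
lemma integral_of_toSignedMeasure_eq {α α' : Measure X} [IsFiniteMeasure α]
    [IsFiniteMeasure α'] {δ : SignedMeasure X} {t : ℝ}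
    (h : α'.toSignedMeasure = α.toSignedMeasure + t • δ) {k : X → ℝ}
    (hk : ∀ μ : Measure X, IsFiniteMeasure μ → Integrable k μ) :
    ∫ x, k x ∂α' = ∫ x, k x ∂α + t * signedPairing δ k := by
  set P := δ.toJordanDecomposition.posPart with hP
  set N := δ.toJordanDecomposition.negPart with hN
  have h' : α'.toSignedMeasure =
      α.toSignedMeasure + t • (P.toSignedMeasure - N.toSignedMeasure) := by
    rw [h]
    exact congrArg (fun ξ => α.toSignedMeasure + t • ξ)
      (SignedMeasure.toSignedMeasure_toJordanDecomposition δ).symm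
  clear h
  rw [signedPairing, ← hP, ← hN]
  rcases le_total 0 t with ht | ht
  · lift t to ℝ≥0 using ht
    have hm : α' + t • N = α + t • P := by
      rw [← Measure.toSignedMeasure_eq_toSignedMeasure_iff, Measure.toSignedMeasure_add,
        Measure.toSignedMeasure_add, Measure.toSignedMeasure_smul, Measure.toSignedMeasure_smul,
        h', smul_sub]
      simp only [NNReal.smul_def]
      abel
    have hi := congrArg (fun μ => ∫ x, k x ∂μ) hm
    rw [integral_add_measure (hk _ inferInstance) (hk _ inferInstance),
      integral_add_measure (hk _ inferInstance) (hk _ inferInstance),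
      integral_smul_nnreal_measure, integral_smul_nnreal_measure] at hi
    simp only [NNReal.smul_def, smul_eq_mul] at hi
    linarith
  · obtain ⟨s, hs⟩ : ∃ s : ℝ≥0, (s : ℝ) = -t := ⟨⟨-t, by linarith⟩, rfl⟩
    obtain rfl : t = -(s : ℝ) := by linarith
    have hm : α' + s • P = α + s • N := by
      rw [← Measure.toSignedMeasure_eq_toSignedMeasure_iff, Measure.toSignedMeasure_add,
        Measure.toSignedMeasure_add, Measure.toSignedMeasure_smul, Measure.toSignedMeasure_smul,
        h', smul_sub]
      simp only [NNReal.smul_def, neg_smul]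
      abel
    have hi := congrArg (fun μ => ∫ x, k x ∂μ) hm
    rw [integral_add_measure (hk _ inferInstance) (hk _ inferInstance),
      integral_add_measure (hk _ inferInstance) (hk _ inferInstance),
      integral_smul_nnreal_measure, integral_smul_nnreal_measure] at hi
    simp only [NNReal.smul_def, smul_eq_mul] at hi
    linarith

lemma signedPairing_neg_sub (δ : SignedMeasure X) {k l : X → ℝ} (c : ℝ)
    (hk : ∀ μ : Measure X, IsFiniteMeasure μ → Integrable k μ)
    (hl : ∀ μ : Measure X, IsFiniteMeasure μ → Integrable l μ) :
    signedPairing δ (fun x => -k x - c * l x) = -signedPairing δ k - c * signedPairing δ l := by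
  have key : ∀ μ : Measure X, IsFiniteMeasure μ →
      ∫ x, (-k x - c * l x) ∂μ = -∫ x, k x ∂μ - c * ∫ x, l x ∂μ := by
    intro μ hμ
    rw [integral_sub (f := fun x => -k x) (hk μ hμ).neg ((hl μ hμ).const_mul c), integral_neg, integral_const_mul]
  rw [signedPairing, key _ inferInstance, key _ inferInstance, signedPairing, signedPairing]
  ring

end Signed

lemma continuous_signedPairing_right {X : Type*} [MetricSpace X] [CompactSpace X]
    [MeasurableSpace X] [BorelSpace X] (δ : SignedMeasure X) {E : X × X → ℝ} (hE : Continuous E) :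
    Continuous fun x => signedPairing δ fun y => E (x, y) :=
  (continuous_integral_right _ hE).sub (continuous_integral_right _ hE)

lemma integral_signedPairing {X : Type*} [MetricSpace X] [CompactSpace X]
    [MeasurableSpace X] [BorelSpace X] (α : Measure X) [IsFiniteMeasure α] (δ : SignedMeasure X)
    {E : X × X → ℝ} (hE : Continuous E) :
    ∫ x, signedPairing δ (fun y => E (x, y)) ∂α = signedPairing δ fun y => ∫ x, E (x, y) ∂α := by
  simp only [signedPairing]
  rw [integral_sub (integrable_of_continuous α (continuous_integral_right _ hE))
    (integrable_of_continuous α (continuous_integral_right _ hE)),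
    integral_integral_swap (f := fun x y => E (x, y)) (integrable_of_continuous _ hE),
    integral_integral_swap (f := fun x y => E (x, y)) (integrable_of_continuous _ hE)]

/-! ### Dual optimality -/

section ExtIntegral

variable {X : Type*} [MeasurableSpace X]

lemma extIntegral_mono (μ : Measure X) {h k : X → EReal} (hk : ∀ x, k x ≤ h x) :
    extIntegral μ k ≤ extIntegral μ h := by
  refine EReal.sub_le_sub (EReal.coe_ennreal_le_coe_ennreal_iff.2 ?_)
    (EReal.coe_ennreal_le_coe_ennreal_iff.2 ?_)
  · exact lintegral_mono fun x => EReal.toENNReal_le_toENNReal (hk x)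
  · exact lintegral_mono fun x => EReal.toENNReal_le_toENNReal (EReal.neg_le_neg_iff.2 (hk x))

lemma extIntegral_coe {μ : Measure X} {k : X → ℝ} (hk : Integrable k μ) :
    extIntegral μ (fun x => (k x : EReal)) = ((∫ x, k x ∂μ : ℝ) : EReal) := by
  have h1 : ∫⁻ x, ENNReal.ofReal (k x) ∂μ ≠ ⊤ := by
    have := hk.lintegral_lt_top
    exact this.ne
  have h2 : ∫⁻ x, ENNReal.ofReal (-k x) ∂μ ≠ ⊤ := by
    have := hk.neg.lintegral_lt_top
    exact this.ne
  rw [extIntegral, integral_eq_lintegral_pos_part_sub_lintegral_neg_part hk, EReal.coe_sub,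
    EReal.coe_ennreal_toReal h1, EReal.coe_ennreal_toReal h2]
  simp only [← EReal.coe_neg, EReal.toENNReal_of_ne_top (EReal.coe_ne_top _), EReal.toReal_coe]

end ExtIntegral

section Differentiability

variable {X : Type*} [MetricSpace X] [CompactSpace X] [MeasurableSpace X]
  [BorelSpace X] {C : X → X → ℝ} {ε : ℝ}

/-- The first-order optimality conditions of the dual problem. -/
structure IsDualCritical (φ : ℝ≥0 → ℝ≥0∞) (C : X → X → ℝ) (ε : ℝ) (α β : Measure X)
    (f g : X → ℝ) : Prop where
  left : ∀ x, IsSubgradient (conj φ) (-f x) (∫ y, Real.exp ((f x + g y - C x y) / ε) ∂β)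
  right : ∀ y, IsSubgradient (conj φ) (-g y) (∫ x, Real.exp ((f x + g y - C x y) / ε) ∂α)

omit [MetricSpace X] [CompactSpace X] [BorelSpace X] in
lemma isDualCritical_of_isSoftResponse (hC_symm : ∀ x y, C x y = C y x) {α β : Measure X}
    {f g : X → ℝ} (hf : IsSoftResponse φ C ε β g f) (hg : IsSoftResponse φ C ε α f g) :
    IsDualCritical φ C ε α β f g := by
  refine ⟨hf, fun y => ?_⟩
  have e : ∀ x, g y + f x - C y x = f x + g y - C x y := fun x => by rw [hC_symm y x]; ring
  simpa only [e] using hg y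

namespace IsDualCritical

lemma continuous_left (hC : Continuous fun z : X × X => C z.1 z.2) (hφ : IsEntropyFunction φ)
    {α β : Measure X} [IsFiniteMeasure β] {f g : X → ℝ}
    (hf : Continuous f) (hg : Continuous g) (h : IsDualCritical φ C ε α β f g) :
    Continuous fun x => (conj φ (-f x)).toReal :=
  continuous_toReal_conj hφ hf.neg (continuous_integral_right β
    (E := fun z : X × X => Real.exp ((f z.1 + g z.2 - C z.1 z.2) / ε)) (by fun_prop)) h.left

lemma continuous_right (hC : Continuous fun z : X × X => C z.1 z.2) (hφ : IsEntropyFunction φ)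
    {α β : Measure X} [IsFiniteMeasure α] {f g : X → ℝ}
    (hf : Continuous f) (hg : Continuous g) (h : IsDualCritical φ C ε α β f g) :
    Continuous fun y => (conj φ (-g y)).toReal :=
  continuous_toReal_conj hφ hg.neg (continuous_integral_right α
    (E := fun z : X × X => Real.exp ((f z.2 + g z.1 - C z.2 z.1) / ε))
      (by have := hC.comp continuous_swap; simp only [Function.comp_def] at this; fun_prop)) h.right

/-- Critical potentials maximize the dual functional. -/
lemma dualFunctional_le (hC : Continuous fun z : X × X => C z.1 z.2) (hε : 0 < ε)
    (hφ : IsEntropyFunction φ) {α β : FiniteMeasure X} {f g f' g' : X → ℝ}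
    (hf : Continuous f) (hg : Continuous g) (h : IsDualCritical φ C ε α β f g)
    (hf' : Continuous f') (hg' : Continuous g') :
    dualFunctional φ C ε α β f' g' ≤ dualFunctional φ C ε α β f g := by
  have hfc := h.continuous_left hC hφ hf hg
  have hgc := h.continuous_right hC hφ hf hg
  set E : X × X → ℝ := fun z => Real.exp ((f z.1 + g z.2 - C z.1 z.2) / ε) with hE
  set E' : X × X → ℝ := fun z => Real.exp ((f' z.1 + g' z.2 - C z.1 z.2) / ε) with hE'
  have hEc : Continuous E := by fun_prop
  have hEc' : Continuous E' := by fun_prop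
  set A : X → ℝ := fun x => ∫ y, E (x, y) ∂(β : Measure X) with hA
  set B : X → ℝ := fun y => ∫ x, E (x, y) ∂(α : Measure X) with hB
  have hAc : Continuous A := continuous_integral_right (β : Measure X) hEc
  have hBc : Continuous B := continuous_integral_right (α : Measure X) (E := fun z => E (z.2, z.1))
    (by fun_prop)
  -- `φ*(-f')` may be infinite, so it is compared with the finite supporting line at `-f` inside the
  -- extended integral.
  have h1 := extIntegral_mono (α : Measure X) (h := fun x => conj φ (-f' x))
    (k := fun x => (((conj φ (-f x)).toReal + A x * (f x - f' x) : ℝ) : EReal)) fun x => by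
      have := h.left x (-f' x)
      rwa [← coe_toReal_conj hφ ((h.left x).conj_ne_top hφ), ← EReal.coe_add,
        show -f' x - -f x = f x - f' x by ring] at this
  have h2 := extIntegral_mono (β : Measure X) (h := fun x => conj φ (-g' x))
    (k := fun x => (((conj φ (-g x)).toReal + B x * (g x - g' x) : ℝ) : EReal)) fun x => by
      have := h.right x (-g' x)
      rwa [← coe_toReal_conj hφ ((h.right x).conj_ne_top hφ), ← EReal.coe_add,
        show -g' x - -g x = g x - g' x by ring] at this
  have e1 : extIntegral (α : Measure X) (fun x => conj φ (-f x)) =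
      ((∫ x, (conj φ (-f x)).toReal ∂(α : Measure X) : ℝ) : EReal) := by
    rw [← extIntegral_coe (integrable_of_continuous _ hfc)]
    simp only [coe_toReal_conj hφ ((h.left _).conj_ne_top hφ)]
  have e2 : extIntegral (β : Measure X) (fun x => conj φ (-g x)) =
      ((∫ x, (conj φ (-g x)).toReal ∂(β : Measure X) : ℝ) : EReal) := by
    rw [← extIntegral_coe (integrable_of_continuous _ hgc)]
    simp only [coe_toReal_conj hφ ((h.right _).conj_ne_top hφ)]
  rw [extIntegral_coe (integrable_of_continuous _ (by fun_prop))] at h1 h2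
  rw [dualFunctional, dualFunctional, e1, e2]
  refine (EReal.sub_le_sub (EReal.sub_le_sub (EReal.neg_le_neg_iff.2 h1) h2) le_rfl).trans ?_
  rw [← EReal.coe_neg, ← EReal.coe_neg, ← EReal.coe_sub, ← EReal.coe_sub, ← EReal.coe_sub,
    ← EReal.coe_sub, EReal.coe_le_coe_iff]
  set ρ := (α : Measure X).prod (β : Measure X) with hρ
  have i1 : ∫ x, A x * (f x - f' x) ∂(α : Measure X) = ∫ z, E z * (f z.1 - f' z.1) ∂ρ := by
    rw [hρ, integral_prod _ (integrable_of_continuous _ (by fun_prop))]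
    simp only [integral_mul_const, hA]
  have i2 : ∫ y, B y * (g y - g' y) ∂(β : Measure X) = ∫ z, E z * (g z.2 - g' z.2) ∂ρ := by
    rw [hρ, integral_prod_symm _ (integrable_of_continuous _ (by fun_prop))]
    simp only [integral_mul_const, hB]
  -- Tangent inequality of the exponential; its linear part is cancelled by the slopes `A` and `B`
  -- of the supporting lines.
  have i3 : ε * ∫ z, (E z - 1) ∂ρ ≤ ∫ z, E z * (f z.1 - f' z.1) ∂ρ +
      ∫ z, E z * (g z.2 - g' z.2) ∂ρ + ε * ∫ z, (E' z - 1) ∂ρ := by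
    rw [← integral_const_mul, ← integral_const_mul,
      ← integral_add (integrable_of_continuous _ (by fun_prop))
      (integrable_of_continuous _ (by fun_prop)),
      ← integral_add (integrable_of_continuous _ (by fun_prop))
      (integrable_of_continuous _ (by fun_prop))]
    refine integral_mono (integrable_of_continuous _ (by fun_prop))
      (integrable_of_continuous _ (by fun_prop)) fun z => ?_
    set d := (f' z.1 + g' z.2) - (f z.1 + g z.2) with hd
    have h1 : E z * (d / ε + 1) ≤ E' z := by
      have : E' z = E z * Real.exp (d / ε) := by
        simp only [hE, hE', hd]
        rw [← Real.exp_add]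
        congr 1
        ring
      rw [this]
      exact mul_le_mul_of_nonneg_left (Real.add_one_le_exp _) (Real.exp_pos _).le
    have h2 := mul_le_mul_of_nonneg_left h1 hε.le
    have h3 : ε * (E z * (d / ε + 1)) = E z * d + ε * E z := by field_simp
    have h4 : E z * d = -(E z * (f z.1 - f' z.1)) - E z * (g z.2 - g' z.2) := by rw [hd]; ring
    simp only
    linarith
  rw [integral_add (integrable_of_continuous _ (by fun_prop))
    (integrable_of_continuous _ (by fun_prop)), integral_add (integrable_of_continuous _ (by fun_prop))
    (integrable_of_continuous _ (by fun_prop)), i1, i2]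
  linarith

end IsDualCritical

/-! ### Differentiability -/

/-- Expansion of the dual value at fixed potentials. -/
lemma dualValue_perturb (hC : Continuous fun z : X × X => C z.1 z.2)
    {α β α' β' : Measure X} [IsFiniteMeasure α] [IsFiniteMeasure β] [IsFiniteMeasure α']
    [IsFiniteMeasure β'] {f g : X → ℝ} (hf : Continuous f) (hg : Continuous g)
    (hfc : Continuous fun x => (conj φ (-f x)).toReal)
    (hgc : Continuous fun y => (conj φ (-g y)).toReal) {δα δβ : SignedMeasure X} {t : ℝ}
    (hα : α'.toSignedMeasure = α.toSignedMeasure + t • δα)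
    (hβ : β'.toSignedMeasure = β.toSignedMeasure + t • δβ) :
    dualValue φ C ε α' β' f g = dualValue φ C ε α β f g +
      t * signedPairing δα (fun x => -(conj φ (-f x)).toReal -
        ε * ∫ y, (Real.exp ((f x + g y - C x y) / ε) - 1) ∂β) +
      t * signedPairing δβ (fun y => -(conj φ (-g y)).toReal -
        ε * ∫ x, (Real.exp ((f x + g y - C x y) / ε) - 1) ∂α) -
      ε * t ^ 2 * signedPairing δα (fun x => signedPairing δβ fun y =>
        Real.exp ((f x + g y - C x y) / ε) - 1) := by
  set L : X × X → ℝ := fun z => Real.exp ((f z.1 + g z.2 - C z.1 z.2) / ε) - 1 with hL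
  have hLc : Continuous L := by fun_prop
  have hLx : ∀ x, Continuous fun y => L (x, y) := fun x => by fun_prop
  have hb : Continuous fun x => ∫ y, L (x, y) ∂β := continuous_integral_right β hLc
  have hb' : Continuous fun y => ∫ x, L (x, y) ∂α :=
    continuous_integral_right α (E := fun z => L (z.2, z.1)) (by fun_prop)
  have he : Continuous fun x => signedPairing δβ fun y => L (x, y) :=
    continuous_signedPairing_right δβ hLc
  have hint : ∀ {k : X → ℝ}, Continuous k → ∀ μ : Measure X, IsFiniteMeasure μ →
      Integrable k μ := fun hk μ _ => integrable_of_continuous μ hk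
  have hprod : ∫ z, L z ∂(α'.prod β') = ∫ z, L z ∂(α.prod β) +
      t * signedPairing δα (fun x => ∫ y, L (x, y) ∂β) +
      t * signedPairing δβ (fun y => ∫ x, L (x, y) ∂α) +
      t ^ 2 * signedPairing δα (fun x => signedPairing δβ fun y => L (x, y)) := by
    rw [integral_prod _ (integrable_of_continuous _ hLc),
      integral_prod _ (integrable_of_continuous _ hLc)]
    simp only [integral_of_toSignedMeasure_eq hβ (hint (hLx _))]
    rw [integral_add (integrable_of_continuous _ hb)
      ((integrable_of_continuous _ he).const_mul t), integral_const_mul,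
      integral_of_toSignedMeasure_eq hα (hint hb), integral_of_toSignedMeasure_eq hα (hint he),
      integral_signedPairing α δβ hLc]
    ring
  have s1 := signedPairing_neg_sub δα ε (hint hfc) (hint hb)
  have s2 := signedPairing_neg_sub δβ ε (hint hgc) (hint hb')
  simp only [hL] at s1 s2 hprod
  rw [s1, s2, dualValue, dualValue, integral_of_toSignedMeasure_eq hα (hint hfc),
    integral_of_toSignedMeasure_eq hβ (hint hgc), hprod]
  ring

/-- The `o(t)` upper bound: the old potentials still define a plan for the new measures, with
marginal densities moved by `O(|t|)`. Uniform stability multiplies that by an arbitrarily small `η`.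
-/
lemma IsDualCritical.eventually_OT_le (hC : Continuous fun z : X × X => C z.1 z.2) (hε : 0 < ε)
    (hφ : IsEntropyFunction φ) (h₁ : ConjStrictConvex φ) {α β : FiniteMeasure X} {f g : X → ℝ}
    (hf : Continuous f) (hg : Continuous g) (h : IsDualCritical φ C ε α β f g)
    (δα δβ : SignedMeasure X) {c : ℝ} (hc : 0 < c) :
    ∀ᶠ t : ℝ in 𝓝 0, ∀ α' β' : FiniteMeasure X,
      (α' : Measure X).toSignedMeasure = (α : Measure X).toSignedMeasure + t • δα →
      (β' : Measure X).toSignedMeasure = (β : Measure X).toSignedMeasure + t • δβ →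
      OT φ C ε α' β' ≤ ((dualValue φ C ε α' β' f g + c * |t| : ℝ) : EReal) := by
  have hfc := h.continuous_left hC hφ hf hg
  have hgc := h.continuous_right hC hφ hf hg
  set E : X × X → ℝ := fun z => Real.exp ((f z.1 + g z.2 - C z.1 z.2) / ε) with hE
  have hEc : Continuous E := by fun_prop
  have hEc' : Continuous fun z : X × X => E (z.2, z.1) := by fun_prop
  obtain ⟨M, hM0, hM⟩ := exists_abs_le_of_continuous (continuous_signedPairing_right δβ hEc)
  obtain ⟨N, hN0, hN⟩ := exists_abs_le_of_continuous (continuous_signedPairing_right δα hEc')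
  have hint : ∀ {k : X → ℝ}, Continuous k → ∀ μ : Measure X, IsFiniteMeasure μ →
      Integrable k μ := fun hk μ _ => integrable_of_continuous μ hk
  set Λ : ℝ := (α : Measure X).real Set.univ + (β : Measure X).real Set.univ +
    |signedPairing δα fun _ => 1| + |signedPairing δβ fun _ => 1| with hΛ
  have hΛ0 : 0 ≤ Λ := by positivity
  -- `M + N + 1` bounds the speed of both marginal densities and `Λ + 1` the total mass of the
  -- perturbed measures for `|t| < 1`, so the full error is at most `c |t|`.
  set η := c / ((M + N + 1) * (Λ + 1)) with hη
  have hηpos : 0 < η := by positivity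
  have hηeq : η * ((M + N + 1) * (Λ + 1)) = c := by rw [hη]; field_simp
  obtain ⟨τ, hτ, HA⟩ := exists_uniform_stability hφ h₁ hf.neg
    (continuous_integral_right (β : Measure X) hEc) h.left hηpos
  obtain ⟨τ', hτ', HB⟩ := exists_uniform_stability hφ h₁ hg.neg
    (continuous_integral_right (α : Measure X) hEc') h.right hηpos
  have hsmall : ∀ᶠ t : ℝ in 𝓝 0, |t| < min 1 (min τ τ' / (M + N + 1)) := by
    refine (continuous_abs.tendsto (0 : ℝ)).eventually (gt_mem_nhds ?_)
    rw [abs_zero]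
    have : 0 < min τ τ' := lt_min hτ hτ'
    positivity
  filter_upwards [hsmall] with t ht α' β' hα' hβ'
  have ht1 : |t| < 1 := ht.trans_le (min_le_left _ _)
  have ht2 : |t| * (M + N + 1) < min τ τ' := by
    rw [← lt_div_iff₀ (by positivity)]
    exact ht.trans_le (min_le_right _ _)
  have hAd : ∀ x, |∫ y, E (x, y) ∂(β' : Measure X) - ∫ y, E (x, y) ∂(β : Measure X)| ≤
      |t| * (M + N + 1) := by
    intro x
    rw [integral_of_toSignedMeasure_eq hβ' (hint (by fun_prop)), add_sub_cancel_left, abs_mul]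
    exact mul_le_mul_of_nonneg_left (by linarith [hM x]) (abs_nonneg _)
  have hBd : ∀ y, |∫ x, E (x, y) ∂(α' : Measure X) - ∫ x, E (x, y) ∂(α : Measure X)| ≤
      |t| * (M + N + 1) := by
    intro y
    rw [integral_of_toSignedMeasure_eq hα' (hint (by fun_prop)), add_sub_cancel_left, abs_mul]
    exact mul_le_mul_of_nonneg_left (by linarith [hN y]) (abs_nonneg _)
  set κ := η * (|t| * (M + N + 1)) with hκ
  have hκ0 : 0 ≤ κ := by positivity
  have KA := fun x => HA x (∫ y, E (x, y) ∂(β' : Measure X))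
    (integral_nonneg fun y => (Real.exp_pos _).le)
    ((hAd x).trans_lt (ht2.trans_le (min_le_left _ _)))
  have KB := fun y => HB y (∫ x, E (x, y) ∂(α' : Measure X))
    (integral_nonneg fun x => (Real.exp_pos _).le)
    ((hBd y).trans_lt (ht2.trans_le (min_le_right _ _)))
  have LA := fun x => mul_le_mul_of_nonneg_left (hAd x) hηpos.le
  have LB := fun x => mul_le_mul_of_nonneg_left (hBd x) hηpos.le
  have hmain := OT_le_dualValue_add (φ := φ) hC hε α' β' hf hg hfc hgc (κ := κ)
    (A := fun x => ∫ y, E (x, y) ∂(β' : Measure X)) (B := fun y => ∫ x, E (x, y) ∂(α' : Measure X))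
    (fun x => rfl) (fun y => rfl)
    (fun x => (KA x).1.trans (add_le_add_right (LA x) _))
    (fun y => (KB y).1.trans (add_le_add_right (LB y) _))
    (fun x => (KA x).2.trans (ENNReal.ofReal_le_ofReal (add_le_add_right (LA x) _)))
    (fun y => (KB y).2.trans (ENNReal.ofReal_le_ofReal (add_le_add_right (LB y) _)))
  refine hmain.trans (EReal.coe_le_coe_iff.2 (add_le_add_right ?_ _))
  have hmass : (α' : Measure X).real Set.univ + (β' : Measure X).real Set.univ ≤ Λ + 1 := by
    have m1 := integral_of_toSignedMeasure_eq hα' (k := fun _ => 1) (hint continuous_const)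
    have m2 := integral_of_toSignedMeasure_eq hβ' (k := fun _ => 1) (hint continuous_const)
    simp only [integral_const, smul_eq_mul, mul_one] at m1 m2
    have b : ∀ s : ℝ, t * s ≤ |s| := fun s => by
      calc t * s ≤ |t * s| := le_abs_self _
        _ = |t| * |s| := abs_mul _ _
        _ ≤ 1 * |s| := mul_le_mul_of_nonneg_right ht1.le (abs_nonneg _)
        _ = |s| := one_mul _
    rw [m1, m2, hΛ]
    linarith [b (signedPairing δα fun _ => 1), b (signedPairing δβ fun _ => 1)]
  calc κ * ((α' : Measure X).real Set.univ + (β' : Measure X).real Set.univ)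
      ≤ κ * (Λ + 1) := mul_le_mul_of_nonneg_left hmass hκ0
    _ = η * ((M + N + 1) * (Λ + 1)) * |t| := by rw [hκ]; ring
    _ = c * |t| := by rw [hηeq]

/-- At critical potentials the marginals are in exact Fenchel duality, so the upper bound holds with
`κ = 0` and meets weak duality. -/
lemma IsDualCritical.OT_eq (hC : Continuous fun z : X × X => C z.1 z.2) (hε : 0 < ε)
    (hφ : IsEntropyFunction φ) {α β : FiniteMeasure X} {f g : X → ℝ}
    (hf : Continuous f) (hg : Continuous g) (h : IsDualCritical φ C ε α β f g) :
    OT φ C ε α β = (dualValue φ C ε α β f g : EReal) := by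
  have hfc := h.continuous_left hC hφ hf hg
  have hgc := h.continuous_right hC hφ hf hg
  refine le_antisymm ?_ (dualValue_le_OT hC hε hφ α β hf hg
    (fun x => (h.left x).conj_ne_top hφ) (fun y => (h.right y).conj_ne_top hφ) hfc hgc)
  have key : ∀ {q s : ℝ}, 0 ≤ s → IsSubgradient (conj φ) q s →
      0 ≤ s * q - (conj φ q).toReal + 0 ∧
        φ s.toNNReal ≤ ENNReal.ofReal (s * q - (conj φ q).toReal + 0) := by
    intro q s hs hsub
    lift s to ℝ≥0 using hs
    have h0 := hsub.le hφ (y := 0) (by simp [conj_zero hφ])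
    rw [toReal_conj_zero hφ] at h0
    rw [add_zero, Real.toNNReal_coe]
    exact ⟨by linarith, hsub.apply_le hφ⟩
  have KA := fun x => key (integral_nonneg fun y => (Real.exp_pos _).le) (h.left x)
  have KB := fun y => key (integral_nonneg fun x => (Real.exp_pos _).le) (h.right y)
  simpa using OT_le_dualValue_add (φ := φ) hC hε α β hf hg hfc hgc (κ := 0) (fun x => rfl)
    (fun y => rfl) (fun x => (KA x).1) (fun y => (KB y).1) (fun x => (KA x).2) (fun y => (KB y).2)

lemma IsDualCritical.hasMeasureGradientAt (hC : Continuous fun z : X × X => C z.1 z.2)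
    (hε : 0 < ε) (hφ : IsEntropyFunction φ) (h₁ : ConjStrictConvex φ) {α β : FiniteMeasure X}
    {f g : X → ℝ} (hf : Continuous f) (hg : Continuous g) (h : IsDualCritical φ C ε α β f g)
    {G₁ G₂ : C(X, ℝ)}
    (hG₁ : ∀ x, G₁ x = -(conj φ (-f x)).toReal -
        ε * ∫ y, (Real.exp ((f x + g y - C x y) / ε) - 1) ∂(β : Measure X))
    (hG₂ : ∀ y, G₂ y = -(conj φ (-g y)).toReal -
        ε * ∫ x, (Real.exp ((f x + g y - C x y) / ε) - 1) ∂(α : Measure X)) :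
    HasMeasureGradientAt (OT φ C ε) G₁ G₂ α β := by
  classical
  have hfc := h.continuous_left hC hφ hf hg
  have hgc := h.continuous_right hC hφ hf hg
  set v := dualValue φ C ε α β f g with hv
  refine ⟨v, h.OT_eq hC hε hφ hf hg, fun δα δβ => ?_⟩
  let P : ℝ → FiniteMeasure X → FiniteMeasure X → Prop := fun t α' β' =>
    (α' : Measure X).toSignedMeasure = (α : Measure X).toSignedMeasure + t • δα ∧
    (β' : Measure X).toSignedMeasure = (β : Measure X).toSignedMeasure + t • δβ
  -- The perturbed measures are determined by `t`, so the remainder can be a function of `t` alone;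
  -- where none exist it is set to `0`.
  have hPuniq : ∀ {t α' β' α'' β''}, P t α' β' → P t α'' β'' → α' = α'' ∧ β' = β'' := by
    intro t α' β' α'' β'' h h'
    exact ⟨FiniteMeasure.toMeasure_injective
        (Measure.toSignedMeasure_eq_toSignedMeasure_iff.1 (h.1.trans h'.1.symm)),
      FiniteMeasure.toMeasure_injective
        (Measure.toSignedMeasure_eq_toSignedMeasure_iff.1 (h.2.trans h'.2.symm))⟩
  let ℓ : ℝ → ℝ := fun t => v + t * signedPairing δα G₁ + t * signedPairing δβ G₂
  set Q := signedPairing δα (fun x => signedPairing δβ fun y =>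
        Real.exp ((f x + g y - C x y) / ε) - 1) with hQ
  have hbounds : ∀ c : ℝ, 0 < c → ∀ᶠ t : ℝ in 𝓝 0, ∀ α' β' : FiniteMeasure X, P t α' β' →
      ∃ s : ℝ, OT φ C ε α' β' = (s : EReal) ∧ |s - ℓ t| ≤ c * |t| := by
    intro c hc
    have hsmall : ∀ᶠ t : ℝ in 𝓝 0, |t| < c / 2 / (ε * |Q| + 1) := by
      refine (continuous_abs.tendsto (0 : ℝ)).eventually (gt_mem_nhds ?_)
      rw [abs_zero]
      positivity
    filter_upwards [h.eventually_OT_le hC hε hφ h₁ hf hg δα δβ (half_pos hc), hsmall]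
      with t hup ht α' β' hP
    have h1 := hup α' β' hP.1 hP.2
    have h2 := dualValue_le_OT hC hε hφ α' β' hf hg
      (fun x => (h.left x).conj_ne_top hφ) (fun y => (h.right y).conj_ne_top hφ) hfc hgc
    have hreal : ((OT φ C ε α' β').toReal : EReal) = OT φ C ε α' β' :=
      EReal.coe_toReal (ne_top_of_le_ne_top (EReal.coe_ne_top _) h1)
        (ne_bot_of_le_ne_bot (EReal.coe_ne_bot _) h2)
    refine ⟨(OT φ C ε α' β').toReal, hreal.symm, ?_⟩
    rw [← hreal, EReal.coe_le_coe_iff] at h1 h2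
    have hexp := dualValue_perturb (φ := φ) (ε := ε) hC hf hg hfc hgc hP.1 hP.2
    simp only [← hG₁, ← hG₂] at hexp
    rw [← hv, ← hQ] at hexp
    rw [hexp] at h1 h2
    have hq : |ε * t ^ 2 * Q| ≤ c / 2 * |t| := by
      rw [lt_div_iff₀ (by positivity)] at ht
      have e : |ε * t ^ 2 * Q| = |t| * (ε * |Q|) * |t| := by
        rw [abs_mul, abs_mul, abs_of_pos hε, abs_pow]; ring
      rw [e]
      refine mul_le_mul_of_nonneg_right ?_ (abs_nonneg _)
      nlinarith [abs_nonneg t]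
    have hq' := abs_le.1 hq
    have hct : 0 ≤ c * |t| := by positivity
    simp only [ℓ]
    rw [abs_le]
    constructor <;> linarith
  let r : ℝ → ℝ := fun t => if hP : ∃ p : FiniteMeasure X × FiniteMeasure X, P t p.1 p.2 then
    (OT φ C ε hP.choose.1 hP.choose.2).toReal - ℓ t else 0
  have hr : ∀ {t α' β'}, P t α' β' → r t = (OT φ C ε α' β').toReal - ℓ t := by
    intro t α' β' hP
    have hex : ∃ p : FiniteMeasure X × FiniteMeasure X, P t p.1 p.2 := ⟨(α', β'), hP⟩
    obtain ⟨e1, e2⟩ := hPuniq hex.choose_spec hP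
    simp only [r, dif_pos hex, e1, e2]
  refine ⟨r, Asymptotics.isLittleO_iff.2 fun c hc => ?_, ?_⟩
  · filter_upwards [hbounds c hc] with t ht
    by_cases hex : ∃ p : FiniteMeasure X × FiniteMeasure X, P t p.1 p.2
    · obtain ⟨p, hp⟩ := hex
      obtain ⟨s, hs, hsl⟩ := ht p.1 p.2 hp
      rw [hr hp, hs, EReal.toReal_coe]
      exact hsl
    · simp only [r, dif_neg hex, norm_zero]
      positivity
  · filter_upwards [hbounds 1 one_pos] with t ht α' β' h1 h2
    obtain ⟨s, hs, -⟩ := ht α' β' ⟨h1, h2⟩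
    rw [hr (α' := α') (β' := β') ⟨h1, h2⟩, hs, EReal.toReal_coe]
    simp [ℓ]

end Differentiability

end UnbalancedOT

/-! ### The main theorem -/

theorem mainTheorem5 {X : Type*} [MetricSpace X] [CompactSpace X] [MeasurableSpace X]
    [BorelSpace X] (C : X → X → ℝ) (γ : ℝ) (ε : ℝ) (φ : ℝ≥0 → ℝ≥0∞)
    (hC_cont : Continuous (fun z : X × X => C z.1 z.2))
    (hC_symm : ∀ x y, C x y = C y x)
    (hC_diag : ∀ x, C x x = 0)
    (hC_lip : ∀ x y z, |C x z - C y z| ≤ γ * dist x y)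
    (hε : 0 < ε)
    (hφ : UnbalancedOT.IsEntropyFunction φ)
    (h₁ : UnbalancedOT.ConjStrictConvex φ)
    (h₂ : UnbalancedOT.ConjSlopesDegenerate φ)
    (α β : FiniteMeasure X) (hα : α ≠ 0) (hβ : β ≠ 0) :
    (∃! p : C(X, ℝ) × C(X, ℝ), UnbalancedOT.IsSinkhornFixedPoint φ C ε α β p.1 p.2) ∧
    ∀ f g : C(X, ℝ), UnbalancedOT.IsSinkhornFixedPoint φ C ε α β f g →
      (∀ f' g' : C(X, ℝ), UnbalancedOT.dualFunctional φ C ε α β f' g' ≤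
        UnbalancedOT.dualFunctional φ C ε α β f g) ∧
      (∃ G₁ G₂ : C(X, ℝ),
        (∀ x, (G₁ x : EReal) = -UnbalancedOT.conj φ (-f x) -
          ((ε * ∫ y, (Real.exp ((f x + g y - C x y) / ε) - 1) ∂(β : Measure X) : ℝ) : EReal)) ∧
        (∀ y, (G₂ y : EReal) = -UnbalancedOT.conj φ (-g y) -
          ((ε * ∫ x, (Real.exp ((f x + g y - C x y) / ε) - 1) ∂(α : Measure X) : ℝ) : EReal)) ∧
        UnbalancedOT.HasMeasureGradientAt (UnbalancedOT.OT φ C ε) G₁ G₂ α β) ∧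
      (∀ x, (∃ d, UnbalancedOT.HasFiniteDerivAt (UnbalancedOT.conj φ) d (-f x)) →
        UnbalancedOT.HasFiniteDerivAt (UnbalancedOT.conj φ)
          (∫ y, Real.exp ((f x + g y - C x y) / ε) ∂(β : Measure X)) (-f x)) ∧
      (∀ y, (∃ d, UnbalancedOT.HasFiniteDerivAt (UnbalancedOT.conj φ) d (-g y)) →
        UnbalancedOT.HasFiniteDerivAt (UnbalancedOT.conj φ)
          (∫ x, Real.exp ((f x + g y - C x y) / ε) ∂(α : Measure X)) (-g y)) := by
  have hα' : NeZero (α : Measure X) :=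
    ⟨fun h => hα (FiniteMeasure.toMeasure_injective (by simpa using h))⟩
  have hβ' : NeZero (β : Measure X) :=
    ⟨fun h => hβ (FiniteMeasure.toMeasure_injective (by simpa using h))⟩
  have hiff : ∀ f g : C(X, ℝ), UnbalancedOT.IsSinkhornFixedPoint φ C ε α β f g ↔
      UnbalancedOT.IsSoftResponse φ C ε β g f ∧ UnbalancedOT.IsSoftResponse φ C ε α f g :=
    fun f g => UnbalancedOT.isSinkhornFixedPoint_iff hC_cont hC_symm hε hφ h₁ α β hα hβ
      f.continuous g.continuous
  refine ⟨?_, fun f g hfg => ?_⟩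
  · obtain ⟨f, g, hf, hg⟩ := UnbalancedOT.exists_fixedPoint (α : Measure X) (β : Measure X)
      hC_cont hC_lip hε hφ h₁ h₂
    refine ⟨(f, g), (hiff f g).2 ⟨hf, hg⟩, ?_⟩
    rintro ⟨f', g'⟩ h'
    obtain ⟨hf', hg'⟩ := (hiff f' g').1 h'
    obtain ⟨rfl, rfl⟩ := UnbalancedOT.fixedPoint_unique (α : Measure X) (β : Measure X)
      hC_cont hC_symm hε hφ h₁ hf hg hf' hg'
    rfl
  obtain ⟨hf, hg⟩ := (hiff f g).1 hfg
  have hcrit := UnbalancedOT.isDualCritical_of_isSoftResponse hC_symm hf hg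
  have hfc := hcrit.continuous_left hC_cont hφ f.continuous g.continuous
  have hgc := hcrit.continuous_right hC_cont hφ f.continuous g.continuous
  refine ⟨fun f' g' => hcrit.dualFunctional_le hC_cont hε hφ f.continuous g.continuous
    f'.continuous g'.continuous, ?_,
    fun x ⟨d, hd⟩ => (hcrit.left x).hasFiniteDerivAt hφ hd,
    fun y ⟨d, hd⟩ => (hcrit.right y).hasFiniteDerivAt hφ hd⟩
  have hL : Continuous fun z : X × X => Real.exp ((f z.1 + g z.2 - C z.1 z.2) / ε) - 1 := by
    fun_prop
  have hL' : Continuous fun z : X × X => Real.exp ((f z.2 + g z.1 - C z.2 z.1) / ε) - 1 :=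
    hL.comp continuous_swap
  refine ⟨⟨fun x => -(UnbalancedOT.conj φ (-f x)).toReal -
      ε * ∫ y, (Real.exp ((f x + g y - C x y) / ε) - 1) ∂(β : Measure X),
      hfc.neg.sub ((UnbalancedOT.continuous_integral_right _ hL).const_mul ε)⟩,
    ⟨fun y => -(UnbalancedOT.conj φ (-g y)).toReal -
      ε * ∫ x, (Real.exp ((f x + g y - C x y) / ε) - 1) ∂(α : Measure X),
      hgc.neg.sub ((UnbalancedOT.continuous_integral_right _ hL').const_mul ε)⟩,
    fun x => ?_, fun y => ?_,
    hcrit.hasMeasureGradientAt hC_cont hε hφ h₁ f.continuous g.continuous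
      (fun _ => rfl) (fun _ => rfl)⟩
  · rw [ContinuousMap.coe_mk, EReal.coe_sub, EReal.coe_neg,
      UnbalancedOT.coe_toReal_conj hφ ((hcrit.left x).conj_ne_top hφ)]
  · rw [ContinuousMap.coe_mk, EReal.coe_sub, EReal.coe_neg,
      UnbalancedOT.coe_toReal_conj hφ ((hcrit.right y).conj_ne_top hφ)]
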